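/- For a lattice $\Lambda\subset\mathbb{R}^n$ of full rank put $\Theta_\Lambda(z)=\sum_{x\in\Lambda}e^{\pi i\|x\|^2z}$ for $\operatorname{Im} z>0$, and define the secrecy function $\Xi_\Lambda(y)=\Theta_{\mathbb{Z}^n}(yi)/\Theta_\Lambda(yi)$ for $y>0$ and the secrecy gain $\chi_\Lambda=\max_{y>0}\Xi_\Lambda(y)$. The length of a vector $x$ means $\|x\|^2$. The lattice is unimodular if its inner products are integers and its determinant is $\pm1$, and even if all lengths are even. The Belfiore–Solé conjecture asserts that for every unimodular lattice the secrecy function attains its maximum over $y>0$ at $y=1$. Let $m\ge 0$, $k\in\{0,1,2\}$, $n=24m+8k$, and let $\Lambda,\Lambda'$ be even unimodular lattices in $\mathbb{R}^n$ all of whose nonzero vectors have length at least $2m$. Let $k_{2m}$ and $k_{2m}'$ be the numbers of vectors of length $2m$ in $\Lambda$ and $\Lambda'$, respectively. Then the maxima defining $\chi_\Lambda$ and $\chi_{\Lambda'}$ are attained, and: (a) if $k_{2m}>k_{2m}'$, then $\Xi_\Lambda(y)<\Xi_{\Lambda'}(y)$ for every $y>0$, and $\chi_\Lambda<\chi_{\Lambda'}$;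 (b) if the Belfiore–Solé conjecture holds for $\Lambda$ and for $\Lambda'$ (in particular, if it holds in general), then $$\frac1{\chi_\Lambda}-\frac1{\chi_{\Lambda'}}=(k_{2m}-k_{2m}')\,\frac{3^k}{4^{6m+k}}.$$ -/

import Mathlib

noncomputable section

/-- The theta function `Θ_Λ(z) = ∑_{x ∈ Λ} exp(π i ‖x‖² z)` (used on the upper half plane). -/
def latticeTheta {n : ℕ} (Λ : Submodule ℤ (EuclideanSpace ℝ (Fin n))) (z : ℂ) : ℂ :=
  ∑' x : Λ, Complex.exp (Real.pi * Complex.I * ((‖(x : EuclideanSpace ℝ (Fin n))‖ ^ 2 : ℝ) : ℂ) * z)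

/-- The cubic lattice `ℤⁿ ⊆ ℝⁿ`. -/
def cubicLattice (n : ℕ) : Submodule ℤ (EuclideanSpace ℝ (Fin n)) :=
  Submodule.span ℤ (Set.range (EuclideanSpace.basisFun (Fin n) ℝ))

/-- The secrecy function `Ξ_Λ(y) = Θ_{ℤⁿ}(y i) / Θ_Λ(y i)`, for `y > 0`. The quotient is a real
number (see `latticeTheta_mul_I`), so taking the real part only changes its type. -/
def secrecyFunction {n : ℕ} (Λ : Submodule ℤ (EuclideanSpace ℝ (Fin n))) (y : ℝ) : ℝ :=
  (latticeTheta (cubicLattice n) (y * Complex.I) / latticeTheta Λ (y * Complex.I)).re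

/-- On the imaginary axis the theta function is real. -/
theorem latticeTheta_mul_I {n : ℕ} (Λ : Submodule ℤ (EuclideanSpace ℝ (Fin n))) (y : ℝ) :
    latticeTheta Λ (y * Complex.I) =
      ((∑' x : Λ, Real.exp (-Real.pi * y * ‖(x : EuclideanSpace ℝ (Fin n))‖ ^ 2) : ℝ) : ℂ) := by
  rw [latticeTheta, Complex.ofReal_tsum]
  refine tsum_congr fun x => ?_
  rw [Complex.ofReal_exp]
  congr 1
  push_cast
  linear_combination
    (Real.pi * (‖(x : EuclideanSpace ℝ (Fin n))‖ : ℂ) ^ 2 * y) * Complex.I_mul_I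

/-- The secrecy gain: the maximum of the secrecy function over `y > 0`. -/
def secrecyGain {n : ℕ} (Λ : Submodule ℤ (EuclideanSpace ℝ (Fin n))) : ℝ :=
  sSup (secrecyFunction Λ '' Set.Ioi 0)

/-- The assertion of the Belfiore–Solé conjecture for the lattice `Λ`: the secrecy function attains
its maximum over `y > 0` at `y = 1`. The conjecture says that this holds for every unimodular
lattice. -/
def SatisfiesBelfioreSole {n : ℕ} (Λ : Submodule ℤ (EuclideanSpace ℝ (Fin n))) : Prop :=
  IsMaxOn (secrecyFunction Λ) (Set.Ioi 0) 1

/-- A full lattice in `ℝⁿ` is even unimodular if its inner products are integers, its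
covolume (the absolute value of its determinant) is `1`, and all `‖x‖²` are even integers. -/
structure IsEvenUnimodular {n : ℕ} (Λ : Submodule ℤ (EuclideanSpace ℝ (Fin n)))
    [DiscreteTopology Λ] [IsZLattice ℝ Λ] : Prop where
  integral : ∀ x ∈ Λ, ∀ y ∈ Λ, ∃ a : ℤ, inner ℝ x y = (a : ℝ)
  covolume_eq_one : ZLattice.covolume Λ = 1
  even : ∀ x ∈ Λ, ∃ a : ℤ, ‖x‖ ^ 2 = 2 * (a : ℝ)

/-- The number of vectors of `Λ` of length `l`, where the length of `x` is `‖x‖²`. -/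
def numVectors {n : ℕ} (Λ : Submodule ℤ (EuclideanSpace ℝ (Fin n))) (l : ℕ) : ℕ :=
  {x : EuclideanSpace ℝ (Fin n) | x ∈ Λ ∧ ‖x‖ ^ 2 = (l : ℝ)}.ncard

end

open Complex Real Filter Topology MatrixGroups ModularForm
open UpperHalfPlane hiding I

/-! The theta series of an even unimodular lattice of dimension 24m + 8k is modular of weight 12m +
4k and level one: evenness gives z ↦ z + 1, and self-duality with Poisson summation gives z ↦ -1/z.
If no nonzero vector is shorter than 2m, two such series first differ at q^m. Dividing the
difference by Δ^m, which has no zeros, gives a form of weight 4k < 12 whose value at the cusp is c =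
k_{2m} - k_{2m}'. Subtracting c E₄^k leaves a cusp form of weight below 12, which vanishes. Hence
Θ_Λ - Θ_Λ' = c Δ^m E₄^k (`latticeTheta_sub_eq`).

On the imaginary axis Δ and E₄ are positive, so the sign of c orders the theta series and,
inversely, the secrecy functions; this gives (a) once the maxima exist. For (b), 1/Ξ is Θ_Λ/Θ_{ℤⁿ},
evaluated at i, where Θ_{ℤⁿ} = θ₃ⁿ, E₄(i) = (3/4) θ₃(i)⁸ and Δ(i) = θ₃(i)²⁴/4⁶. Both values come
from expressing E₄ and Δ by theta constants (`thetaEight_I`, `etaPow_I`), and those expressions rest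
on the same vanishing lemma.

The maximum exists because Ξ is invariant under y ↦ 1/y, tends to 1, and exceeds 1 for some y when n
> 0. -/

/-- `g` is holomorphic on the upper half plane and transforms like a modular form of weight `k` and
level one; no condition is imposed at the cusp. -/
structure IsWeaklyModular (k : ℤ) (g : ℂ → ℂ) : Prop where
  differentiableOn : DifferentiableOn ℂ g {z | 0 < z.im}
  add_one : ∀ z : ℂ, 0 < z.im → g (z + 1) = g z
  neg_inv : ∀ z : ℂ, 0 < z.im → g (-1 / z) = z ^ k * g z

/-! ### Weakly modular functions and vanishing below weight 12. -/

namespace IsWeaklyModular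

variable {k l : ℤ} {f g : ℂ → ℂ}

theorem sub (hf : IsWeaklyModular k f) (hg : IsWeaklyModular k g) :
    IsWeaklyModular k (fun z => f z - g z) where
  differentiableOn := hf.differentiableOn.sub hg.differentiableOn
  add_one z hz := by rw [hf.add_one z hz, hg.add_one z hz]
  neg_inv z hz := by rw [hf.neg_inv z hz, hg.neg_inv z hz]; ring

theorem const_mul (hf : IsWeaklyModular k f) (c : ℂ) : IsWeaklyModular k (fun z => c * f z) where
  differentiableOn := hf.differentiableOn.const_mul c
  add_one z hz := by rw [hf.add_one z hz]
  neg_inv z hz := by rw [hf.neg_inv z hz]; ring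

theorem pow (hf : IsWeaklyModular k f) (m : ℕ) : IsWeaklyModular (k * m) (fun z => f z ^ m) where
  differentiableOn := hf.differentiableOn.pow m
  add_one z hz := by rw [hf.add_one z hz]
  neg_inv z hz := by rw [hf.neg_inv z hz, mul_pow, zpow_mul, zpow_natCast]

theorem div (hf : IsWeaklyModular k f) (hg : IsWeaklyModular l g)
    (h0 : ∀ z : ℂ, 0 < z.im → g z ≠ 0) : IsWeaklyModular (k - l) (fun z => f z / g z) where
  differentiableOn := hf.differentiableOn.div hg.differentiableOn h0
  add_one z hz := by rw [hf.add_one z hz, hg.add_one z hz]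
  neg_inv z hz := by
    have hz0 : z ≠ 0 := by rintro rfl; simp at hz
    rw [hf.neg_inv z hz, hg.neg_inv z hz, zpow_sub₀ hz0, mul_div_mul_comm]

theorem slash_S_apply (f : ℍ → ℂ) (k : ℤ) (z : ℍ) :
    (f ∣[k] ModularGroup.S) z =
      f ⟨-1 / (z : ℂ), by simpa [neg_div, one_div] using z.im_inv_neg_coe_pos⟩ *
        ((z : ℂ) ^ k)⁻¹ := by
  rw [ModularForm.SL_slash_apply, UpperHalfPlane.modular_S_smul, ModularGroup.denom_S, zpow_neg]
  congr 2
  ext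
  simp [neg_div, one_div, inv_neg]

theorem slash_T_apply (f : ℍ → ℂ) (k : ℤ) (z : ℍ) :
    (f ∣[k] ModularGroup.T) z = f ((1 : ℝ) +ᵥ z) := by
  rw [ModularForm.SL_slash_apply, UpperHalfPlane.modular_T_smul, ModularGroup.denom_apply]
  simp [ModularGroup.T]

/-- A weakly modular function of weight less than `12` which tends to zero at the cusp vanishes. -/
theorem eq_zero_of_weight_lt_twelve (hg : IsWeaklyModular k g) (hk : k < 12)
    (hlim : Tendsto (fun z : ℍ => g z) atImInfty (𝓝 0)) {z : ℂ} (hz : 0 < z.im) : g z = 0 := by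
  let f : ℍ → ℂ := fun z => g z
  have hS : f ∣[k] ModularGroup.S = f := by
    ext z
    have hz0 : (z : ℂ) ^ k ≠ 0 := zpow_ne_zero _ z.ne_zero
    rw [slash_S_apply]
    change g (-1 / (z : ℂ)) * _ = g z
    rw [hg.neg_inv z z.2, mul_right_comm, mul_inv_cancel₀ hz0, one_mul]
  have hT : f ∣[k] ModularGroup.T = f := by
    ext z
    rw [slash_T_apply]
    exact (congrArg g (by simp [add_comm])).trans (hg.add_one z z.2)
  have hγ := SlashInvariantForm.slash_action_generators_SL2Z hS hT
  let F : CuspForm 𝒮ℒ k :=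
    { toFun := f
      slash_action_eq' := by
        rintro _ ⟨A, rfl⟩
        exact hγ A
      holo' := by
        rw [UpperHalfPlane.mdifferentiable_iff]
        refine DifferentiableOn.congr hg.differentiableOn fun w hw => ?_
        simp [f, ofComplex_apply_of_im_pos hw]
      -- Every cusp is an SL₂(ℤ)-translate of ∞ and `f` is invariant, so the limit at ∞ suffices.
      zero_at_cusps' := fun hc => by
        rw [Subgroup.IsArithmetic.isCusp_iff_isCusp_SL2Z] at hc
        rw [OnePoint.isZeroAt_iff_forall_SL2Z hc]
        intro γ _
        rw [hγ]
        exact hlim }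
  have hF : F = 0 := rank_zero_iff_forall_zero.mp (CuspForm.rank_eq_zero_of_weight_lt_twelve hk) F
  exact DFunLike.congr_fun hF (⟨z, hz⟩ : ℍ)

end IsWeaklyModular

/-! ### The discriminant. -/

/-- The modular discriminant `η ^ 24`, as a function on `ℂ`. -/
noncomputable def etaPow (z : ℂ) : ℂ := ModularForm.eta z ^ 24

theorem etaPow_coe (z : ℍ) : etaPow z = ModularForm.discriminant z := rfl

theorem etaPow_ne_zero (z : ℂ) (hz : 0 < z.im) : etaPow z ≠ 0 :=
  pow_ne_zero _ (ModularForm.eta_ne_zero hz)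

theorem isWeaklyModular_etaPow : IsWeaklyModular 12 etaPow where
  differentiableOn z hz :=
    ((ModularForm.differentiableAt_eta_of_mem_upperHalfPlaneSet hz).pow 24).differentiableWithinAt
  add_one z hz := by
    have h := congrFun ModularForm.discriminant_T_invariant (⟨z, hz⟩ : ℍ)
    rw [IsWeaklyModular.slash_T_apply] at h
    exact (congrArg etaPow (by simp [add_comm])).trans h
  neg_inv z hz := by
    have h := congrFun ModularForm.discriminant_S_invariant (⟨z, hz⟩ : ℍ)
    have hz0 : z ^ (12 : ℤ) ≠ 0 := zpow_ne_zero _ (by rintro rfl; simp at hz)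
    rw [IsWeaklyModular.slash_S_apply] at h
    replace h : etaPow (-1 / z) * (z ^ (12 : ℤ))⁻¹ = etaPow z := h
    rw [← h, mul_left_comm, mul_inv_cancel₀ hz0, mul_one]

/-- From Δ = q ∏ (1 - qⁿ)²⁴: the zero at the cusp is simple with leading coefficient 1. -/
theorem tendsto_etaPow_div_exp :
    Tendsto (fun z : ℍ => etaPow z / cexp (2 * π * I * z)) atImInfty (𝓝 1) := by
  refine ModularForm.tendsto_atImInfty_tprod_one_sub_eta_q_pow.congr fun z => ?_
  rw [etaPow_coe, ModularForm.discriminant_eq_q_prod, Function.Periodic.qParam]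
  simp [mul_div_cancel_left₀, Complex.exp_ne_zero]

/-! ### Theta constants and their transformation laws. -/

/-- The theta constant `θ₂(τ) = ∑ exp(π i (n + 1/2)² τ)`. -/
noncomputable def thetaTwo (τ : ℂ) : ℂ := cexp (π * I * τ / 4) * jacobiTheta₂ (τ / 2) τ

/-- The theta constant `θ₄(τ) = ∑ (-1)ⁿ exp(π i n² τ)`. -/
noncomputable def thetaFour (τ : ℂ) : ℂ := jacobiTheta₂ (1 / 2) τ

/-- Since n² - n is even, the factor exp(πi n²) equals exp(πi n), a half-period shift in `z`. -/
theorem jacobiTheta₂_add_one_right (z τ : ℂ) :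
    jacobiTheta₂ z (τ + 1) = jacobiTheta₂ (z + 1 / 2) τ := by
  refine tsum_congr fun n => ?_
  rw [jacobiTheta₂_term, jacobiTheta₂_term, Complex.exp_eq_exp_iff_exists_int]
  obtain ⟨a, ha⟩ : Even (n ^ 2 - n) := by
    rw [show n ^ 2 - n = n * (n - 1) by ring]
    exact Int.even_mul_pred_self n
  refine ⟨a, ?_⟩
  have ha' : (n : ℂ) ^ 2 - n = a + a := by exact_mod_cast ha
  linear_combination π * I * ha'

theorem jacobiTheta_add_one (τ : ℂ) : jacobiTheta (τ + 1) = thetaFour τ := by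
  rw [jacobiTheta_eq_jacobiTheta₂, jacobiTheta₂_add_one_right, zero_add, thetaFour]

theorem thetaFour_add_one (τ : ℂ) : thetaFour (τ + 1) = jacobiTheta τ := by
  rw [thetaFour, jacobiTheta₂_add_one_right, jacobiTheta_eq_jacobiTheta₂, add_halves,
    ← jacobiTheta₂_add_left 0, zero_add]

/-- The prefactor picks up an eighth root of unity, exp(πi/4). Fourth powers reduce it to a sign,
and also remove the square root in the inversion formulas. -/
theorem thetaTwo_add_one_pow (τ : ℂ) : thetaTwo (τ + 1) ^ 4 = -thetaTwo τ ^ 4 := by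
  have h : jacobiTheta₂ ((τ + 1) / 2) (τ + 1) = jacobiTheta₂ (τ / 2) τ := by
    rw [jacobiTheta₂_add_one_right, ← jacobiTheta₂_add_left (τ / 2)]
    congr 1; ring
  rw [thetaTwo, thetaTwo, h, mul_pow, mul_pow, ← Complex.exp_nat_mul, ← Complex.exp_nat_mul,
    show ((4 : ℕ) : ℂ) * (π * I * (τ + 1) / 4) = ((4 : ℕ) : ℂ) * (π * I * τ / 4) + π * I by
      push_cast; ring, Complex.exp_add, Complex.exp_pi_mul_I]
  ring

theorem cpow_half_pow_four {z : ℂ} (hz : z ≠ 0) : ((-I * z) ^ (1 / 2 : ℂ)) ^ 4 = -z ^ 2 := by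
  have h : -I * z ≠ 0 := mul_ne_zero (neg_ne_zero.mpr I_ne_zero) hz
  rw [← Complex.cpow_nat_mul, show ((4 : ℕ) : ℂ) * (1 / 2) = ((2 : ℕ) : ℂ) by push_cast; norm_num,
    Complex.cpow_natCast, mul_pow, neg_sq, I_sq, neg_one_mul]

theorem thetaTwo_functional_equation {τ : ℂ} (hτ : τ ≠ 0) :
    thetaTwo τ = 1 / (-I * τ) ^ (1 / 2 : ℂ) * thetaFour (-1 / τ) := by
  rw [thetaTwo, jacobiTheta₂_functional_equation, thetaFour,
    show -π * I * (τ / 2) ^ 2 / τ = -(π * I * τ / 4) by field_simp; ring,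
    show τ / 2 / τ = 1 / 2 by field_simp, Complex.exp_neg]
  field_simp [Complex.exp_ne_zero]

theorem thetaFour_functional_equation {τ : ℂ} (hτ : τ ≠ 0) :
    thetaFour τ = 1 / (-I * τ) ^ (1 / 2 : ℂ) * thetaTwo (-1 / τ) := by
  rw [thetaFour, jacobiTheta₂_functional_equation, thetaTwo, mul_assoc,
    ← jacobiTheta₂_neg_left (1 / 2 / τ),
    show -π * I * (1 / 2) ^ 2 / τ = π * I * (-1 / τ) / 4 by field_simp; ring,
    show -(1 / 2 / τ) = -1 / τ / 2 by field_simp]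

theorem jacobiTheta_functional_equation (τ : ℂ) :
    jacobiTheta τ = 1 / (-I * τ) ^ (1 / 2 : ℂ) * jacobiTheta (-1 / τ) := by
  rw [jacobiTheta_eq_jacobiTheta₂, jacobiTheta₂_functional_equation, jacobiTheta_eq_jacobiTheta₂]
  simp

theorem pow_four_of_functional_equation {f g : ℂ → ℂ} {τ : ℂ} (hτ : τ ≠ 0)
    (h : f τ = 1 / (-I * τ) ^ (1 / 2 : ℂ) * g (-1 / τ)) : g (-1 / τ) ^ 4 = -τ ^ 2 * f τ ^ 4 := by
  have h0 : (-τ ^ 2 : ℂ) ≠ 0 := neg_ne_zero.mpr (pow_ne_zero _ hτ)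
  rw [h, mul_pow, div_pow, one_pow, cpow_half_pow_four hτ, ← mul_assoc, mul_one_div_cancel h0,
    one_mul]

theorem differentiableOn_jacobiTheta : DifferentiableOn ℂ jacobiTheta {z | 0 < z.im} :=
  fun _ hz => (differentiableAt_jacobiTheta hz).differentiableWithinAt

theorem differentiableOn_thetaFour : DifferentiableOn ℂ thetaFour {z | 0 < z.im} :=
  fun _ hz => (differentiableAt_jacobiTheta₂_snd _ hz).differentiableWithinAt

theorem differentiableOn_thetaTwo : DifferentiableOn ℂ thetaTwo {z | 0 < z.im} := by
  intro z hz
  have h1 : DifferentiableAt ℂ (fun p : ℂ × ℂ => jacobiTheta₂ p.1 p.2) (z / 2, z) :=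
    (hasFDerivAt_jacobiTheta₂ (z / 2) hz).differentiableAt
  have h2 : DifferentiableAt ℂ (fun τ : ℂ => (τ / 2, τ)) z := by fun_prop
  have h3 : DifferentiableAt ℂ (fun τ : ℂ => jacobiTheta₂ (τ / 2) τ) z :=
    h1.comp (f := fun τ : ℂ => (τ / 2, τ)) z h2
  have h4 : DifferentiableAt ℂ (fun τ : ℂ => cexp (π * I * τ / 4)) z := by fun_prop
  exact (h4.mul h3).differentiableWithinAt

/-! ### Level-one functions built from theta constants. -/

/-- The theta series of the `E₈` lattice, in terms of theta constants. -/
noncomputable def thetaEight (τ : ℂ) : ℂ :=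
  ((thetaTwo τ ^ 4) ^ 2 + (jacobiTheta τ ^ 4) ^ 2 + (thetaFour τ ^ 4) ^ 2) / 2

theorem ne_zero_of_im_pos {z : ℂ} (hz : 0 < z.im) : z ≠ 0 := by
  rintro rfl; simp at hz

theorem thetaTwo_neg_inv_pow {τ : ℂ} (hτ : 0 < τ.im) :
    thetaTwo (-1 / τ) ^ 4 = -τ ^ 2 * thetaFour τ ^ 4 :=
  pow_four_of_functional_equation (ne_zero_of_im_pos hτ)
    (thetaFour_functional_equation (ne_zero_of_im_pos hτ))

theorem thetaFour_neg_inv_pow {τ : ℂ} (hτ : 0 < τ.im) :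
    thetaFour (-1 / τ) ^ 4 = -τ ^ 2 * thetaTwo τ ^ 4 :=
  pow_four_of_functional_equation (ne_zero_of_im_pos hτ)
    (thetaTwo_functional_equation (ne_zero_of_im_pos hτ))

theorem jacobiTheta_neg_inv_pow {τ : ℂ} (hτ : 0 < τ.im) :
    jacobiTheta (-1 / τ) ^ 4 = -τ ^ 2 * jacobiTheta τ ^ 4 :=
  pow_four_of_functional_equation (ne_zero_of_im_pos hτ) (jacobiTheta_functional_equation τ)

theorem isWeaklyModular_thetaEight : IsWeaklyModular 4 thetaEight where
  differentiableOn := ((((differentiableOn_thetaTwo.pow 4).pow 2).add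
    ((differentiableOn_jacobiTheta.pow 4).pow 2)).add
    ((differentiableOn_thetaFour.pow 4).pow 2)).div_const 2
  add_one z _ := by
    simp only [thetaEight, thetaTwo_add_one_pow, jacobiTheta_add_one, thetaFour_add_one]
    ring
  neg_inv z hz := by
    simp only [thetaEight, thetaTwo_neg_inv_pow hz, jacobiTheta_neg_inv_pow hz,
      thetaFour_neg_inv_pow hz]
    rw [show (4 : ℤ) = ((4 : ℕ) : ℤ) by rfl, zpow_natCast]
    ring

theorem isWeaklyModular_thetaProduct : IsWeaklyModular 12
    (fun τ => (thetaTwo τ ^ 4 * jacobiTheta τ ^ 4 * thetaFour τ ^ 4) ^ 2) where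
  differentiableOn := (((differentiableOn_thetaTwo.pow 4).mul
    (differentiableOn_jacobiTheta.pow 4)).mul (differentiableOn_thetaFour.pow 4)).pow 2
  add_one z _ := by
    simp only [thetaTwo_add_one_pow, jacobiTheta_add_one, thetaFour_add_one]
    ring
  neg_inv z hz := by
    simp only [thetaTwo_neg_inv_pow hz, jacobiTheta_neg_inv_pow hz, thetaFour_neg_inv_pow hz]
    rw [show (12 : ℤ) = ((12 : ℕ) : ℤ) by rfl, zpow_natCast]
    ring

/-- Translation swaps θ₃ and θ₄ and negates θ₂⁴, so the defect changes sign; inversion multiplies it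
by -τ². Squaring removes both signs. -/
theorem isWeaklyModular_quartic_defect : IsWeaklyModular 4
    (fun τ => (jacobiTheta τ ^ 4 - thetaTwo τ ^ 4 - thetaFour τ ^ 4) ^ 2) where
  differentiableOn := (((differentiableOn_jacobiTheta.pow 4).sub
    (differentiableOn_thetaTwo.pow 4)).sub (differentiableOn_thetaFour.pow 4)).pow 2
  add_one z _ := by
    simp only [thetaTwo_add_one_pow, jacobiTheta_add_one, thetaFour_add_one]
    ring
  neg_inv z hz := by
    simp only [thetaTwo_neg_inv_pow hz, jacobiTheta_neg_inv_pow hz, thetaFour_neg_inv_pow hz]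
    rw [show (4 : ℤ) = ((4 : ℕ) : ℤ) by rfl, zpow_natCast]
    ring

/-! ### Theta constants at the cusp. -/

theorem tendsto_im_atImInfty : Tendsto (fun z : ℍ => z.im) atImInfty atTop := tendsto_comap

theorem tendsto_jacobiTheta_atImInfty :
    Tendsto (fun z : ℍ => jacobiTheta z) atImInfty (𝓝 1) := by
  have h1 : Tendsto (fun z : ℍ => (z : ℂ)) atImInfty (comap Complex.im atTop) :=
    tendsto_comap_iff.mpr tendsto_im_atImInfty
  have h2 : Tendsto (fun τ : ℂ => rexp (-π * τ.im)) (comap Complex.im atTop) (𝓝 0) := by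
    refine Real.tendsto_exp_atBot.comp ?_
    exact tendsto_comap.const_mul_atTop_of_neg (by simp [pi_pos])
  have h3 := (isBigO_at_im_infty_jacobiTheta_sub_one.trans_tendsto h2).comp h1
  simpa using h3.add_const 1

theorem tendsto_thetaFour_atImInfty :
    Tendsto (fun z : ℍ => thetaFour z) atImInfty (𝓝 1) := by
  have h1 : Tendsto (fun z : ℍ => (1 : ℝ) +ᵥ z) atImInfty atImInfty := by
    refine tendsto_comap_iff.mpr ?_
    simpa [Function.comp_def] using tendsto_im_atImInfty
  refine (tendsto_jacobiTheta_atImInfty.comp h1).congr fun z => ?_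
  simp [← jacobiTheta_add_one, add_comm]

theorem norm_jacobiTheta₂_half_term (n : ℤ) (τ : ℂ) :
    ‖jacobiTheta₂_term n (τ / 2) τ‖ = rexp (-π * (n * (n + 1) : ℤ) * τ.im) := by
  rw [norm_jacobiTheta₂_term]
  congr 1
  simp
  ring

/-- The exponent n(n + 1) vanishes only for n = 0 and n = -1; these two terms give the limit 2. The
series at τ = i dominates for Im τ ≥ 1. -/
theorem tendsto_jacobiTheta₂_half_atImInfty :
    Tendsto (fun z : ℍ => jacobiTheta₂ ((z : ℂ) / 2) z) atImInfty (𝓝 2) := by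
  have hnn (n : ℤ) : (0 : ℝ) ≤ (n * (n + 1) : ℤ) := by
    exact_mod_cast (by rcases lt_or_ge n 0 with h | h <;> nlinarith : (0 : ℤ) ≤ n * (n + 1))
  have hsum : Summable fun n : ℤ => ‖jacobiTheta₂_term n (I / 2) I‖ :=
    ((summable_jacobiTheta₂_term_iff (I / 2) I).mpr (by simp)).norm
  have key := tendsto_tsum_of_dominated_convergence (𝓕 := atImInfty)
    (f := fun (z : ℍ) (n : ℤ) => jacobiTheta₂_term n ((z : ℂ) / 2) z)
    (g := fun n => if n ∈ ({0, -1} : Finset ℤ) then (1 : ℂ) else 0) hsum ?_ ?_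
  · rw [tsum_eq_sum (s := {0, -1}) (by simp +contextual)] at key
    norm_num at key
    exact key
  · intro n
    split_ifs with hn
    · refine tendsto_const_nhds.congr fun z => ?_
      simp only [Finset.mem_insert, Finset.mem_singleton] at hn
      rw [jacobiTheta₂_term, eq_comm, ← Complex.exp_zero]
      congr 1
      rcases hn with rfl | rfl
      · simp
      · push_cast; ring
    · rw [tendsto_zero_iff_norm_tendsto_zero]
      simp only [norm_jacobiTheta₂_half_term]
      refine Real.tendsto_exp_atBot.comp ?_
      refine tendsto_im_atImInfty.const_mul_atTop_of_neg ?_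
      have : (n * (n + 1) : ℤ) ≠ 0 := by
        simp only [Finset.mem_insert, Finset.mem_singleton, not_or] at hn
        exact mul_ne_zero hn.1 (by omega)
      have := lt_of_le_of_ne (hnn n) (by exact_mod_cast this.symm)
      nlinarith [pi_pos]
  · filter_upwards [tendsto_im_atImInfty.eventually_ge_atTop 1] with z hz n
    rw [norm_jacobiTheta₂_half_term, norm_jacobiTheta₂_half_term]
    refine Real.exp_le_exp.mpr ?_
    have := mul_nonneg pi_pos.le (hnn n)
    simp only [Complex.I_im, coe_im]
    nlinarith

theorem tendsto_thetaTwo_pow_div_exp :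
    Tendsto (fun z : ℍ => (thetaTwo z ^ 4) ^ 2 / cexp (2 * π * I * z)) atImInfty (𝓝 256) := by
  have h := tendsto_jacobiTheta₂_half_atImInfty.pow 8
  rw [show (2 : ℂ) ^ 8 = 256 by norm_num] at h
  refine h.congr fun z => ?_
  rw [thetaTwo, ← pow_mul, mul_pow, ← Complex.exp_nat_mul,
    show ((4 * 2 : ℕ) : ℂ) * (π * I * z / 4) = 2 * π * I * z by push_cast; ring,
    mul_div_cancel_left₀ _ (Complex.exp_ne_zero _)]

theorem tendsto_thetaTwo_atImInfty : Tendsto (fun z : ℍ => thetaTwo z) atImInfty (𝓝 0) := by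
  rw [← zero_mul (2 : ℂ)]
  refine Tendsto.mul ?_ tendsto_jacobiTheta₂_half_atImInfty
  rw [tendsto_zero_iff_norm_tendsto_zero]
  simp only [Complex.norm_exp]
  refine Real.tendsto_exp_atBot.comp ?_
  refine (tendsto_im_atImInfty.const_mul_atTop_of_neg (r := -(π / 4)) (by linarith [pi_pos])).congr
    fun z => ?_
  simp
  ring

theorem tendsto_thetaEight_atImInfty : Tendsto (fun z : ℍ => thetaEight z) atImInfty (𝓝 1) := by
  have h := ((((tendsto_thetaTwo_atImInfty.pow 4).pow 2).add
    ((tendsto_jacobiTheta_atImInfty.pow 4).pow 2)).add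
    ((tendsto_thetaFour_atImInfty.pow 4).pow 2)).div_const 2
  norm_num at h
  exact h

/-! ### Identities between theta constants, and values at i. -/

/-- Jacobi's quartic identity for theta constants. -/
theorem jacobiTheta_pow_four {τ : ℂ} (hτ : 0 < τ.im) :
    jacobiTheta τ ^ 4 = thetaTwo τ ^ 4 + thetaFour τ ^ 4 := by
  have hlim := (((tendsto_jacobiTheta_atImInfty.pow 4).sub (tendsto_thetaTwo_atImInfty.pow 4)).sub
    (tendsto_thetaFour_atImInfty.pow 4)).pow 2
  norm_num at hlim
  have h := isWeaklyModular_quartic_defect.eq_zero_of_weight_lt_twelve (by norm_num) hlim hτ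
  linear_combination pow_eq_zero_iff two_ne_zero |>.mp h

/-- The modular discriminant as a product of theta constants. -/
theorem thetaProduct_eq_etaPow {τ : ℂ} (hτ : 0 < τ.im) :
    (thetaTwo τ ^ 4 * jacobiTheta τ ^ 4 * thetaFour τ ^ 4) ^ 2 = 256 * etaPow τ := by
  -- Weight 12 is too large for the vanishing lemma, so the difference is divided by Δ. The quotient
  -- has weight 0 and limit (256 - 256)/1 = 0.
  have hmod := (isWeaklyModular_thetaProduct.sub (isWeaklyModular_etaPow.const_mul 256)).div
    isWeaklyModular_etaPow etaPow_ne_zero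
  have hlim := (((tendsto_thetaTwo_pow_div_exp.mul
    (((tendsto_jacobiTheta_atImInfty.pow 4).mul (tendsto_thetaFour_atImInfty.pow 4)).pow 2)).sub
    (tendsto_etaPow_div_exp.const_mul 256)).div tendsto_etaPow_div_exp one_ne_zero)
  norm_num at hlim
  have h := hmod.eq_zero_of_weight_lt_twelve (by norm_num) (hlim.congr fun z => ?_) hτ
  · rw [div_eq_zero_iff, or_iff_left (etaPow_ne_zero τ hτ)] at h
    exact sub_eq_zero.mp h
  · have := etaPow_ne_zero z z.2
    have := Complex.exp_ne_zero (2 * π * I * z)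
    simp only [Pi.div_apply]
    field_simp

/-- The point i is fixed by τ ↦ -1/τ, and the factor -τ² is 1 there. -/
theorem thetaFour_I_pow : thetaFour I ^ 4 = thetaTwo I ^ 4 := by
  have h := thetaTwo_neg_inv_pow (τ := I) (by simp)
  rw [I_sq, neg_neg, one_mul, show -1 / I = I by rw [div_I]; simp] at h
  exact h.symm

theorem jacobiTheta_I_pow : jacobiTheta I ^ 4 = 2 * thetaTwo I ^ 4 := by
  rw [jacobiTheta_pow_four (by simp), thetaFour_I_pow]; ring

theorem thetaEight_I : thetaEight I = 3 / 4 * jacobiTheta I ^ 8 := by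
  rw [thetaEight, thetaFour_I_pow, show jacobiTheta I ^ 8 = (jacobiTheta I ^ 4) ^ 2 by ring,
    jacobiTheta_I_pow]
  ring

theorem etaPow_I : etaPow I = jacobiTheta I ^ 24 / 4 ^ 6 := by
  have h := thetaProduct_eq_etaPow (τ := I) (by simp)
  rw [thetaFour_I_pow, jacobiTheta_I_pow] at h
  rw [show jacobiTheta I ^ 24 = (jacobiTheta I ^ 4) ^ 6 by ring, jacobiTheta_I_pow]
  linear_combination -h / 256

/-! ### Positivity on the imaginary axis. -/

theorem exists_le_eq_tsum_ofReal {f : ℤ → ℝ} (hf : ∀ n, 0 < f n) {g : ℤ → ℂ} (hg : Summable g)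
    (h : ∀ n, g n = f n) : ∃ r : ℝ, f 0 + f 1 ≤ r ∧ ∑' n, g n = r := by
  have hs : Summable f := by
    have := hg
    simp only [funext h] at this
    exact Complex.summable_ofReal.mp this
  refine ⟨∑' n, f n, ?_, ?_⟩
  · simpa using hs.sum_le_tsum {0, 1} fun n _ => (hf n).le
  rw [Complex.ofReal_tsum]
  exact tsum_congr h

theorem exists_one_add_exp_le_jacobiTheta_mul_I {y : ℝ} (hy : 0 < y) :
    ∃ r : ℝ, 1 + rexp (-π * y) ≤ r ∧ jacobiTheta (y * I) = r := by
  rw [jacobiTheta_eq_jacobiTheta₂]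
  obtain ⟨r, hr, h⟩ := exists_le_eq_tsum_ofReal (f := fun n => rexp (-π * n ^ 2 * y))
    (g := fun n => jacobiTheta₂_term n 0 (y * I)) (fun n => Real.exp_pos _)
    ((summable_jacobiTheta₂_term_iff 0 (y * I)).mpr (by simpa using hy))
    fun n => by
      rw [jacobiTheta₂_term, Complex.ofReal_exp]
      congr 1
      push_cast
      linear_combination (π * (n : ℂ) ^ 2 * y) * I_sq
  exact ⟨r, by simpa using hr, h⟩

theorem exists_pos_jacobiTheta_mul_I {y : ℝ} (hy : 0 < y) :
    ∃ r : ℝ, 0 < r ∧ jacobiTheta (y * I) = r := by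
  obtain ⟨r, hr, h⟩ := exists_one_add_exp_le_jacobiTheta_mul_I hy
  exact ⟨r, lt_of_lt_of_le (by positivity) hr, h⟩

theorem exists_pos_thetaTwo_mul_I {y : ℝ} (hy : 0 < y) :
    ∃ r : ℝ, 0 < r ∧ thetaTwo (y * I) = r := by
  obtain ⟨r, hr, h⟩ := exists_le_eq_tsum_ofReal (f := fun n => rexp (-π * (n * (n + 1)) * y))
    (fun n => Real.exp_pos _) (g := fun n => jacobiTheta₂_term n (y * I / 2) (y * I))
    ((summable_jacobiTheta₂_term_iff _ _).mpr (by simpa using hy)) fun n => by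
      rw [jacobiTheta₂_term, Complex.ofReal_exp]
      congr 1
      push_cast
      linear_combination (π * (n : ℂ) ^ 2 * y + π * n * y) * I_sq
  refine ⟨rexp (-π * y / 4) * r, mul_pos (Real.exp_pos _) (lt_of_lt_of_le (by positivity) hr), ?_⟩
  rw [thetaTwo, jacobiTheta₂, h, Complex.ofReal_mul, Complex.ofReal_exp]
  congr 2
  push_cast
  linear_combination (π * y / 4) * I_sq

theorem neg_one_div_mul_I {y : ℝ} (hy : 0 < y) : -1 / ((y : ℂ) * I) = (y⁻¹ : ℝ) * I := by
  have hy0 : (y : ℂ) ≠ 0 := by exact_mod_cast hy.ne'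
  rw [div_eq_iff (mul_ne_zero hy0 I_ne_zero)]
  push_cast
  field_simp
  rw [I_sq]

/-- The series of θ₄ alternates, so positivity is carried over from θ₂ at i/y by inversion. -/
theorem exists_pos_thetaFour_pow_mul_I {y : ℝ} (hy : 0 < y) :
    ∃ r : ℝ, 0 < r ∧ thetaFour (y * I) ^ 4 = r := by
  obtain ⟨r, hr, h⟩ := exists_pos_thetaTwo_mul_I (inv_pos.mpr hy)
  have hy0 : (y : ℂ) ≠ 0 := by exact_mod_cast hy.ne'
  have h4 := thetaTwo_neg_inv_pow (τ := y * I) (by simpa using hy)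
  rw [neg_one_div_mul_I hy, h] at h4
  refine ⟨r ^ 4 / y ^ 2, by positivity, ?_⟩
  push_cast
  rw [h4, mul_pow, I_sq]
  field_simp

theorem exists_pos_thetaEight_mul_I {y : ℝ} (hy : 0 < y) :
    ∃ r : ℝ, 0 < r ∧ thetaEight (y * I) = r := by
  obtain ⟨a, ha, h2⟩ := exists_pos_thetaTwo_mul_I hy
  obtain ⟨b, hb, h3⟩ := exists_pos_jacobiTheta_mul_I hy
  obtain ⟨c, hc, h4⟩ := exists_pos_thetaFour_pow_mul_I hy
  refine ⟨((a ^ 4) ^ 2 + (b ^ 4) ^ 2 + c ^ 2) / 2, by positivity, ?_⟩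
  rw [thetaEight, h2, h3, h4]
  push_cast
  ring

theorem exists_pos_etaPow_mul_I {y : ℝ} (hy : 0 < y) :
    ∃ r : ℝ, 0 < r ∧ etaPow (y * I) = r := by
  obtain ⟨a, ha, h2⟩ := exists_pos_thetaTwo_mul_I hy
  obtain ⟨b, hb, h3⟩ := exists_pos_jacobiTheta_mul_I hy
  obtain ⟨c, hc, h4⟩ := exists_pos_thetaFour_pow_mul_I hy
  have h := thetaProduct_eq_etaPow (τ := y * I) (by simpa using hy)
  rw [h2, h3, h4] at h
  refine ⟨(a ^ 4 * b ^ 4 * c) ^ 2 / 256, by positivity, ?_⟩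
  push_cast
  linear_combination -h / 256

/-! ### Lattice theta series: convergence and expansion at the cusp. -/

section LatticeSums

variable {n : ℕ} (Λ : Submodule ℤ (EuclideanSpace ℝ (Fin n)))

theorem norm_latticeTheta_term (x : Λ) (z : ℂ) :
    ‖cexp (π * I * ((‖(x : EuclideanSpace ℝ (Fin n))‖ ^ 2 : ℝ) : ℂ) * z)‖ =
      rexp (-(π * z.im) * ‖(x : EuclideanSpace ℝ (Fin n))‖ ^ 2) := by
  rw [Complex.norm_exp]
  congr 1
  rw [mul_assoc, mul_comm (π : ℂ) I, mul_assoc, Complex.I_mul_re,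
    Complex.im_ofReal_mul, Complex.im_ofReal_mul]
  ring

theorem latticeTheta_add_one
    (heven : ∀ x ∈ Λ, ∃ a : ℤ, ‖x‖ ^ 2 = 2 * (a : ℝ)) (z : ℂ) :
    latticeTheta Λ (z + 1) = latticeTheta Λ z := by
  refine tsum_congr fun x => ?_
  obtain ⟨a, ha⟩ := heven x x.2
  rw [ha, Complex.exp_eq_exp_iff_exists_int]
  exact ⟨a, by push_cast; ring⟩

theorem norm_latticeTheta_term_div (x : Λ) (z : ℂ) (j : ℕ) :
    ‖cexp (π * I * ((‖(x : EuclideanSpace ℝ (Fin n))‖ ^ 2 : ℝ) : ℂ) * z) /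
      cexp (2 * π * I * z) ^ j‖ =
      rexp (-(π * (‖(x : EuclideanSpace ℝ (Fin n))‖ ^ 2 - 2 * j)) * z.im) := by
  have h : ‖cexp (2 * π * I * z)‖ = rexp (-(2 * π * z.im)) := by
    rw [Complex.norm_exp]
    congr 1
    simp
  rw [norm_div, norm_pow, norm_latticeTheta_term, h, ← Real.exp_nat_mul, ← Real.exp_sub]
  congr 1
  ring

variable [DiscreteTopology Λ]

theorem summable_exp_neg_mul_norm_sq {c : ℝ} (hc : 0 < c) :
    Summable fun x : Λ => rexp (-c * ‖(x : EuclideanSpace ℝ (Fin n))‖ ^ 2) := by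
  -- An exponent above the rank makes the sum of inverse powers of the norm converge; `2 * d` is
  -- also a power of `‖x‖ ^ 2`. The bound fails at x = 0, hence the cofinite comparison below.
  set d := Module.finrank ℤ Λ + 1 with hd
  have hs := (ZLattice.summable_norm_pow_inv Λ (2 * d) (by omega)).mul_left (d.factorial / c ^ d)
  refine Summable.of_norm_bounded_eventually hs ?_
  filter_upwards [(Set.finite_singleton (0 : Λ)).compl_mem_cofinite] with x hx
  have hx0 : 0 < ‖x‖ := norm_pos_iff.mpr hx
  have h := Real.pow_div_factorial_le_exp (c * ‖x‖ ^ 2) (by positivity) d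
  have hf : (0 : ℝ) < d.factorial := by exact_mod_cast d.factorial_pos
  rw [Real.norm_of_nonneg (Real.exp_pos _).le, neg_mul, Real.exp_neg, inv_pow, pow_mul]
  calc (rexp (c * ‖x‖ ^ 2))⁻¹ ≤ ((c * ‖x‖ ^ 2) ^ d / d.factorial)⁻¹ :=
        inv_anti₀ (by positivity) h
    _ = d.factorial / c ^ d * ((‖x‖ ^ 2) ^ d)⁻¹ := by
        rw [mul_pow]; field_simp

theorem summable_latticeTheta_term {z : ℂ} (hz : 0 < z.im) :
    Summable fun x : Λ => cexp (π * I * ((‖(x : EuclideanSpace ℝ (Fin n))‖ ^ 2 : ℝ) : ℂ) * z) := by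
  refine Summable.of_norm ?_
  simp only [norm_latticeTheta_term]
  exact summable_exp_neg_mul_norm_sq Λ (mul_pos pi_pos hz)

theorem differentiableOn_latticeTheta :
    DifferentiableOn ℂ (latticeTheta Λ) {z | 0 < z.im} := by
  intro z hz
  have hz' : 0 < z.im := hz
  have hopen : IsOpen {w : ℂ | z.im / 2 < w.im} := isOpen_lt continuous_const Complex.continuous_im
  refine ((differentiableOn_tsum_of_summable_norm
    (summable_exp_neg_mul_norm_sq Λ (c := π * (z.im / 2)) (by positivity))
    (fun x => ?_) hopen fun x w hw => ?_).differentiableAt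
    (hopen.mem_nhds (half_lt_self hz'))).differentiableWithinAt
  · fun_prop
  · rw [norm_latticeTheta_term]
    have : z.im / 2 < w.im := hw
    gcongr

theorem finite_norm_sq_eq (r : ℝ) :
    {x : Λ | ‖(x : EuclideanSpace ℝ (Fin n))‖ ^ 2 = r}.Finite := by
  have h := (summable_exp_neg_mul_norm_sq Λ one_pos).tendsto_cofinite_zero.eventually_lt_const
    (Real.exp_pos (-1 * r))
  refine Set.Finite.subset h fun x hx => ?_
  have hx' : ‖(x : EuclideanSpace ℝ (Fin n))‖ ^ 2 = r := hx
  simp [hx']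

/-- If every nonzero vector of `Λ` has length at least `2j`, then the theta series of `Λ` is
`1 + N q ^ j + o(q ^ j)` at the cusp, with `N` the number of nonzero vectors of length `2j`. -/
theorem tendsto_latticeTheta_sub_one_div (j : ℕ)
    (hmin : ∀ x ∈ Λ, x ≠ 0 → 2 * (j : ℝ) ≤ ‖x‖ ^ 2) :
    Tendsto (fun z : ℍ => (latticeTheta Λ z - 1) / cexp (2 * π * I * z) ^ j) atImInfty
      (𝓝 ({x : EuclideanSpace ℝ (Fin n) | x ∈ Λ ∧ x ≠ 0 ∧ ‖x‖ ^ 2 = 2 * j}.ncard : ℂ)) := by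
  classical
  have hfin : {x : Λ | x ≠ 0 ∧ ‖(x : EuclideanSpace ℝ (Fin n))‖ ^ 2 = 2 * (j : ℝ)}.Finite :=
    (finite_norm_sq_eq Λ _).subset fun x hx => hx.2
  have hcard : {x : EuclideanSpace ℝ (Fin n) | x ∈ Λ ∧ x ≠ 0 ∧ ‖x‖ ^ 2 = 2 * (j : ℝ)}.ncard =
      hfin.toFinset.card := by
    rw [← Set.ncard_eq_toFinset_card _ hfin, ← Set.ncard_image_of_injective _ Subtype.val_injective]
    congr 1
    ext x
    simp
    tauto
  have hsum : (∑' x : Λ, if x ∈ hfin.toFinset then (1 : ℂ) else 0) = hfin.toFinset.card := by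
    rw [tsum_eq_sum (s := hfin.toFinset) fun x hx => if_neg hx, Finset.sum_ite_mem,
      Finset.inter_self, Finset.sum_const, nsmul_one]
  rw [hcard, ← hsum]
  -- As ‖x‖² ≥ 2j for x ≠ 0, each quotient decreases in norm with Im z, so its norm at Im z = 1
  -- serves as the bound.
  have key := tendsto_tsum_of_dominated_convergence (𝓕 := atImInfty)
    (bound := fun x : Λ => rexp (2 * π * j) * rexp (-π * ‖(x : EuclideanSpace ℝ (Fin n))‖ ^ 2))
    (f := fun (z : ℍ) (x : Λ) => if x = 0 then (0 : ℂ) else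
      cexp (π * I * ((‖(x : EuclideanSpace ℝ (Fin n))‖ ^ 2 : ℝ) : ℂ) * z) /
        cexp (2 * π * I * z) ^ j)
    (g := fun x : Λ => if x ∈ hfin.toFinset then (1 : ℂ) else 0)
    ((summable_exp_neg_mul_norm_sq Λ pi_pos).mul_left _) ?_ ?_
  · refine key.congr fun z => ?_
    have h := (summable_latticeTheta_term Λ z.2).tsum_eq_add_tsum_ite 0
    rw [latticeTheta, h]
    simp only [ZeroMemClass.coe_zero, norm_zero, ne_eq, OfNat.ofNat_ne_zero, not_false_eq_true,
      zero_pow, Complex.ofReal_zero, mul_zero, zero_mul, Complex.exp_zero, add_sub_cancel_left]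
    rw [← tsum_div_const]
    refine tsum_congr fun x => ?_
    split_ifs <;> simp
  · intro x
    by_cases hx : x = 0
    · simp [hx]
    have hx' : (x : EuclideanSpace ℝ (Fin n)) ≠ 0 := by simpa using hx
    simp only [hx, if_false, Set.Finite.mem_toFinset, Set.mem_ofPred_eq, ne_eq, not_false_eq_true,
      true_and]
    split_ifs with hx2
    · refine tendsto_const_nhds.congr fun z => ?_
      rw [hx2, ← Complex.exp_nat_mul, ← Complex.exp_sub, eq_comm, ← Complex.exp_zero]
      congr 1
      push_cast
      ring
    · rw [tendsto_zero_iff_norm_tendsto_zero]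
      simp only [norm_latticeTheta_term_div]
      refine Real.tendsto_exp_atBot.comp ?_
      refine tendsto_im_atImInfty.const_mul_atTop_of_neg ?_
      have := lt_of_le_of_ne (hmin x x.2 hx') (Ne.symm hx2)
      nlinarith [pi_pos]
  · filter_upwards [tendsto_im_atImInfty.eventually_ge_atTop 1] with z hz x
    split_ifs with hx
    · rw [norm_zero]; positivity
    have hx' : (x : EuclideanSpace ℝ (Fin n)) ≠ 0 := by simpa using hx
    rw [norm_latticeTheta_term_div, ← Real.exp_add, coe_im]
    refine Real.exp_le_exp.mpr ?_
    have := mul_nonneg pi_pos.le (sub_nonneg.mpr (hmin x x.2 hx'))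
    nlinarith

end LatticeSums

/-! ### Poisson summation on the torus. -/

section Poisson

open MeasureTheory UnitAddTorus

variable {d : Type*}

/-- The projection of `ℝᵈ` onto the torus. -/
def toTorus (x : d → ℝ) : UnitAddTorus d := fun i => (x i : UnitAddCircle)

/-- The inclusion of `ℤᵈ` into `ℝᵈ`. -/
def intVec (v : d → ℤ) : d → ℝ := fun i => v i

theorem isOpenQuotientMap_toTorus : IsOpenQuotientMap (toTorus : (d → ℝ) → UnitAddTorus d) :=
  IsOpenQuotientMap.piMap fun _ => QuotientAddGroup.isOpenQuotientMap_mk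

theorem toTorus_add_intVec (x : d → ℝ) (v : d → ℤ) : toTorus (x + intVec v) = toTorus x := by
  ext i
  simp only [toTorus, intVec, Pi.add_apply]
  rw [AddCircle.coe_add, add_eq_left, AddCircle.coe_eq_zero_iff]
  exact ⟨v i, by simp⟩

theorem exists_eq_add_intVec {x y : d → ℝ} (h : toTorus x = toTorus y) :
    ∃ v : d → ℤ, y = x + intVec v := by
  have h' (i : d) : ∃ a : ℤ, y i = x i + a := by
    have hi : ((y i - x i : ℝ) : UnitAddCircle) = 0 := by
      rw [AddCircle.coe_sub, sub_eq_zero]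
      exact (congrFun h i).symm
    obtain ⟨a, ha⟩ := AddCircle.coe_eq_zero_iff _ |>.mp hi
    exact ⟨a, by rw [zsmul_one] at ha; linarith⟩
  choose v hv using h'
  exact ⟨v, funext hv⟩

variable [Fintype d]

theorem mFourier_toTorus (k : d → ℤ) (x : d → ℝ) :
    mFourier k (toTorus x) = cexp (2 * π * I * ((∑ i, k i * x i : ℝ) : ℂ)) := by
  simp only [mFourier, ContinuousMap.coe_mk, toTorus, fourier_coe_apply]
  rw [← Complex.exp_sum]
  congr 1
  push_cast
  rw [Finset.mul_sum]
  refine Finset.sum_congr rfl fun i _ => ?_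
  ring

theorem hasSum_setIntegral_unit_cubes {E : Type*} [NormedAddCommGroup E] [NormedSpace ℝ E]
    {h : (d → ℝ) → E} (hh : Integrable h) :
    HasSum (fun v : d → ℤ => ∫ x in {x : d → ℝ | ∀ i, x i ∈ Set.Ioc (0 : ℝ) (0 + 1)},
      h (x + intVec v)) (∫ x, h x) := by
  let C : (d → ℤ) → Set (d → ℝ) := fun v => {x | ∀ i, x i ∈ Set.Ioc (v i : ℝ) (v i + 1)}
  have hm (v : d → ℤ) : MeasurableSet (C v) := by
    have : C v = Set.univ.pi fun i => Set.Ioc (v i : ℝ) (v i + 1) := by ext; simp [C]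
    rw [this]
    exact MeasurableSet.univ_pi fun i => measurableSet_Ioc
  -- The cubes are open on the left and closed on the right, so x lies in the one with index ⌈x⌉ -
  -- 1.
  have hceil {x : d → ℝ} {v : d → ℤ} (hx : x ∈ C v) (i : d) : ⌈x i⌉ = v i + 1 := by
    rw [Int.ceil_eq_iff]
    have := hx i
    push_cast
    exact ⟨by linarith [this.1], this.2⟩
  have hd : Pairwise (Function.onFun Disjoint C) := by
    intro v w hvw
    refine Set.disjoint_left.mpr fun x hx hx' => hvw (funext fun i => ?_)
    have := (hceil hx i).symm.trans (hceil hx' i)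
    omega
  have hU : ⋃ v, C v = Set.univ := by
    refine Set.eq_univ_of_forall fun x => Set.mem_iUnion.mpr ⟨fun i => ⌈x i⌉ - 1, fun i => ?_⟩
    push_cast
    exact ⟨by linarith [Int.ceil_lt_add_one (x i)], by linarith [Int.le_ceil (x i)]⟩
  have key := hasSum_integral_iUnion hm hd hh.integrableOn
  rw [hU, setIntegral_univ] at key
  refine key.congr_fun fun v => ?_
  have hpre : {x : d → ℝ | ∀ i, x i ∈ Set.Ioc (0 : ℝ) (0 + 1)} = (· + intVec v) ⁻¹' C v := by
    ext x
    simp only [C, intVec, Set.mem_ofPred_eq, Set.mem_preimage, Pi.add_apply, Set.mem_Ioc]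
    refine forall_congr' fun i => ?_
    constructor <;> rintro ⟨h1, h2⟩ <;> constructor <;> linarith
  rw [hpre]
  exact (measurePreserving_add_right volume (intVec v)).setIntegral_preimage_emb
    (measurableEmbedding_addRight _) h (C v)

/-- **Poisson summation** on `ℤᵈ`. -/
theorem tsum_intVec_eq_tsum_fourier {g : (d → ℝ) → ℂ} (hc : Continuous g) (hi : Integrable g)
    (hb : ∀ R : ℝ, ∃ u : (d → ℤ) → ℝ, Summable u ∧ ∀ v x, ‖x‖ ≤ R → ‖g (x + intVec v)‖ ≤ u v)
    (hs : Summable fun k : d → ℤ => ∫ x, mFourier (-k) (toTorus x) * g x) :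
    ∑' v, g (intVec v) = ∑' k, ∫ x, mFourier (-k) (toTorus x) * g x := by
  let P : (d → ℝ) → ℂ := fun x => ∑' v, g (x + intVec v)
  have hPc : Continuous P := by
    refine continuous_iff_continuousAt.mpr fun x => ?_
    obtain ⟨u, hu, hle⟩ := hb (‖x‖ + 1)
    refine (continuousOn_tsum (s := {y | ‖y‖ < ‖x‖ + 1}) (fun v => ?_) hu
      fun v y hy => hle v y (le_of_lt hy)).continuousAt
        ((isOpen_lt continuous_norm continuous_const).mem_nhds (lt_add_one ‖x‖))
    exact (hc.comp (continuous_id.add continuous_const)).continuousOn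
  have hPper (x : d → ℝ) (v : d → ℤ) : P (x + intVec v) = P x := by
    have h := (Equiv.addLeft v).tsum_eq (fun w => g (x + intVec w))
    refine Eq.trans (tsum_congr fun w => ?_) h
    congr 1
    ext i
    simp [intVec, add_assoc]
  -- The periodization descends to the torus through an arbitrary section; periodicity makes the
  -- choice irrelevant.
  let F : UnitAddTorus d → ℂ := fun t => P (Function.surjInv isOpenQuotientMap_toTorus.surjective t)
  have hF (x : d → ℝ) : F (toTorus x) = P x := by
    obtain ⟨v, hv⟩ := exists_eq_add_intVec
      (Function.surjInv_eq isOpenQuotientMap_toTorus.surjective (toTorus x)).symm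
    simp only [F]
    rw [hv, hPper]
  have hFc : Continuous F :=
    isOpenQuotientMap_toTorus.isQuotientMap.continuous_iff.mpr (by
      rw [show F ∘ toTorus = P from funext hF]; exact hPc)
  -- Unfolding: the character is periodic, so the integral of the periodization over one cube
  -- becomes an integral over the whole space.
  have hcoeff (k : d → ℤ) : mFourierCoeff F k = ∫ x, mFourier (-k) (toTorus x) * g x := by
    have hcont : Continuous fun x : d → ℝ => mFourier (-k) (toTorus x) :=
      (mFourier (-k)).continuous.comp isOpenQuotientMap_toTorus.continuous
    have hint : Integrable fun x => mFourier (-k) (toTorus x) * g x := by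
      refine hi.bdd_mul (c := 1) hcont.aestronglyMeasurable (Eventually.of_forall fun x => ?_)
      exact ((mFourier (-k)).norm_coe_le_norm _).trans mFourier_norm.le
    have hnorm := hasSum_setIntegral_unit_cubes hint.norm
    have hsum := hasSum_setIntegral_unit_cubes hint
    rw [mFourierCoeff_eq_integral F k 0, ← hsum.tsum_eq]
    have hswap := hasSum_integral_of_summable_integral_norm
      (μ := volume.restrict {x : d → ℝ | ∀ i, x i ∈ Set.Ioc (0 : ℝ) (0 + 1)})
      (F := fun (v : d → ℤ) x => mFourier (-k) (toTorus (x + intVec v)) * g (x + intVec v))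
      (fun v => (hint.comp_add_right (intVec v)).integrableOn) hnorm.summable
    rw [hswap.tsum_eq]
    refine integral_congr_ae (Eventually.of_forall fun x => ?_)
    simp only [toTorus_add_intVec]
    rw [tsum_mul_left]
    exact congrArg _ (hF x)
  have hsF : Summable (mFourierCoeff (⟨F, hFc⟩ : C(UnitAddTorus d, ℂ))) := by
    refine hs.congr fun k => ?_
    exact (hcoeff k).symm
  have key := (hasSum_mFourier_series_apply_of_summable hsF (toTorus 0)).tsum_eq
  have h0 : F (toTorus 0) = ∑' v, g (intVec v) := by rw [hF]; simp [P]
  rw [← h0]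
  refine Eq.trans key.symm (tsum_congr fun k => ?_)
  rw [mFourier_toTorus]
  simpa using hcoeff k

end Poisson

/-! ### Self-duality and inversion of the lattice theta series. -/

section FunctionalEquation

open MeasureTheory UnitAddTorus Module

variable {n : ℕ} (Λ : Submodule ℤ (EuclideanSpace ℝ (Fin n))) [DiscreteTopology Λ]
  [IsZLattice ℝ Λ]

/-- A `ℤ`-basis of a full lattice in `ℝⁿ`. -/
noncomputable def latticeBasis : Basis (Fin n) ℤ Λ :=
  finBasisOfFinrankEq ℤ Λ (by rw [ZLattice.rank ℝ Λ, finrank_euclideanSpace_fin])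

/-- The basis of `ℝⁿ` formed by a `ℤ`-basis of a full lattice. -/
noncomputable def latticeRealBasis : Basis (Fin n) ℝ (EuclideanSpace ℝ (Fin n)) :=
  (latticeBasis Λ).ofZLatticeBasis ℝ Λ

theorem latticeRealBasis_apply (i : Fin n) : latticeRealBasis Λ i = latticeBasis Λ i :=
  (latticeBasis Λ).ofZLatticeBasis_apply ℝ Λ i

/-- The coordinate isomorphism of `ℝⁿ` given by a `ℤ`-basis of a full lattice. -/
noncomputable def latticeCoord : (Fin n → ℝ) ≃L[ℝ] EuclideanSpace ℝ (Fin n) :=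
  (latticeRealBasis Λ).equivFun.symm.toContinuousLinearEquiv

theorem latticeCoord_apply (x : Fin n → ℝ) :
    latticeCoord Λ x = ∑ i, x i • latticeRealBasis Λ i :=
  (latticeRealBasis Λ).equivFun_symm_apply x

theorem latticeCoord_intVec (v : Fin n → ℤ) :
    latticeCoord Λ (intVec v) = ((latticeBasis Λ).equivFun.symm v : Λ) := by
  rw [latticeCoord_apply, Basis.equivFun_symm_apply, Submodule.coe_sum]
  refine Finset.sum_congr rfl fun i _ => ?_
  rw [latticeRealBasis_apply, intVec, Submodule.coe_smul, Int.cast_smul_eq_zsmul]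

/-- Covolume one says that the parallelepiped of the lattice basis has volume 1, like the unit cube,
which fixes the Haar measure. -/
theorem measurePreserving_latticeCoord (hcov : ZLattice.covolume Λ = 1) :
    MeasurePreserving (latticeCoord Λ) := by
  refine ⟨(latticeCoord Λ).continuous.measurable, ?_⟩
  have hpar : (volume : Measure (EuclideanSpace ℝ (Fin n)))
      ((latticeRealBasis Λ).parallelepiped : Set _) = 1 := by
    have h := ZLattice.covolume_eq_measure_fundamentalDomain Λ volume
      (ZLattice.isAddFundamentalDomain (latticeBasis Λ) volume)
    rw [hcov, measureReal_def, eq_comm, ENNReal.toReal_eq_one_iff,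
      measure_congr (ZSpan.fundamentalDomain_ae_parallelepiped _ volume)] at h
    rw [Basis.coe_parallelepiped]
    exact h
  have hvol : (volume : Measure (Fin n → ℝ)) = (Pi.basisFun ℝ (Fin n)).addHaar := by
    rw [eq_comm, Basis.addHaar_eq_iff, Basis.coe_parallelepiped,
      ← measure_congr (ZSpan.fundamentalDomain_ae_parallelepiped _ volume)]
    simp [ZSpan.fundamentalDomain_pi_basisFun, Real.volume_pi_Ico]
  rw [hvol, Basis.map_addHaar, Basis.addHaar_eq_iff]
  have hbasis : (Pi.basisFun ℝ (Fin n)).map (latticeCoord Λ).toLinearEquiv =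
      latticeRealBasis Λ := by
    refine Basis.eq_of_apply_eq fun i => ?_
    rw [Basis.map_apply, Pi.basisFun_apply]
    refine (latticeCoord_apply Λ _).trans ?_
    rw [Finset.sum_eq_single i] <;> simp +contextual
  rw [hbasis]
  exact hpar

/-- A lattice with integral inner products and covolume one is self-dual. -/
theorem exists_inner_latticeBasis_eq (hint : ∀ x ∈ Λ, ∀ y ∈ Λ, ∃ a : ℤ, inner ℝ x y = (a : ℝ))
    (hcov : ZLattice.covolume Λ = 1) :
    ∃ φ : Λ ≃ (Fin n → ℤ), ∀ (x : Λ) i,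
      inner ℝ (latticeRealBasis Λ i) (x : EuclideanSpace ℝ (Fin n)) =
        (φ x i : ℝ) := by
  have h1 (x : Λ) (i : Fin n) : ∃ a : ℤ, inner ℝ (latticeRealBasis Λ i)
      (x : EuclideanSpace ℝ (Fin n)) = (a : ℝ) := by
    rw [latticeRealBasis_apply]
    exact hint _ (latticeBasis Λ i).2 _ x.2
  choose φ hφ using h1
  have hinj : Function.Injective φ := by
    intro x y hxy
    refine Subtype.ext (InnerProductSpace.ext_inner_left_basis (latticeRealBasis Λ) fun i => ?_)
    rw [hφ, hφ, hxy]
  -- `M` is the Gram matrix, equal to AᵀA with |det A| the covolume. So det M = 1, and M⁻¹ is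
  -- integral, which gives surjectivity.
  let M : Matrix (Fin n) (Fin n) ℤ := Matrix.of fun i j => φ (latticeBasis Λ j) i
  let b₀ := (EuclideanSpace.basisFun (Fin n) ℝ).toBasis
  let A : Matrix (Fin n) (Fin n) ℝ := b₀.toMatrix (latticeRealBasis Λ)
  have hM : M.map (Int.cast : ℤ → ℝ) = A.transpose * A := by
    ext i j
    simp only [M, A, Matrix.map_apply, Matrix.of_apply, Matrix.mul_apply, Matrix.transpose_apply]
    rw [← hφ, ← latticeRealBasis_apply, PiLp.inner_apply]
    refine Finset.sum_congr rfl fun l _ => ?_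
    simp [b₀, Basis.toMatrix_apply, mul_comm]
  have hA : |A.det| = 1 := by
    have h := ZLattice.covolume_eq_det_mul_measureReal (L := Λ) (μ := volume) (latticeBasis Λ) b₀
    have hv : volume.real (ZSpan.fundamentalDomain b₀) = 1 := by
      rw [measureReal_def, measure_congr (ZSpan.fundamentalDomain_ae_parallelepiped _ volume)]
      simp [b₀, OrthonormalBasis.volume_parallelepiped]
    rw [hcov, hv, mul_one, Basis.det_apply] at h
    rw [h]
    exact congrArg (fun w => |(b₀.toMatrix w).det|) (funext (latticeRealBasis_apply Λ))
  have hdet : M.det = 1 := by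
    have h2 : ((M.det : ℤ) : ℝ) = 1 := by
      have h3 := (Int.castRingHom ℝ).map_det M
      rw [RingHom.mapMatrix_apply] at h3
      refine h3.trans ?_
      change (M.map (Int.cast : ℤ → ℝ)).det = 1
      rw [hM, Matrix.det_mul, Matrix.det_transpose, ← abs_mul_abs_self, hA, one_mul]
    exact_mod_cast h2
  have hsurj : Function.Surjective φ := by
    intro k
    let c := M⁻¹.mulVec k
    refine ⟨∑ j, c j • latticeBasis Λ j, ?_⟩
    have hc : M.mulVec c = k := by
      rw [Matrix.mulVec_mulVec, Matrix.mul_nonsing_inv _ (by rw [hdet]; exact isUnit_one),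
        Matrix.one_mulVec]
    ext i
    have : ((φ (∑ j, c j • latticeBasis Λ j) i : ℤ) : ℝ) = (k i : ℝ) := by
      rw [← hφ, Submodule.coe_sum, inner_sum, ← hc, Matrix.mulVec, dotProduct]
      push_cast
      refine Finset.sum_congr rfl fun j _ => ?_
      rw [← Int.cast_smul_eq_zsmul ℝ, inner_smul_right, hφ, mul_comm]
      rfl
    exact_mod_cast this
  exact ⟨Equiv.ofBijective φ ⟨hinj, hsurj⟩, hφ⟩

/-- Poisson summation for a Gaussian in lattice coordinates. By self-duality `φ` identifies the
frequencies with the lattice itself. -/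
theorem latticeTheta_eq_fourier (hint : ∀ x ∈ Λ, ∀ y ∈ Λ, ∃ a : ℤ, inner ℝ x y = (a : ℝ))
    (hcov : ZLattice.covolume Λ = 1) {z : ℂ} (hz : 0 < z.im) :
    latticeTheta Λ z = (I / z) ^ (n / 2 : ℂ) * latticeTheta Λ (-1 / z) := by
  obtain ⟨φ, hφ⟩ := exists_inner_latticeBasis_eq Λ hint hcov
  have hz0 : z ≠ 0 := ne_zero_of_im_pos hz
  set b : ℂ := -(π * I * z) with hb
  have hbre : b.re = π * z.im := by simp [hb]
  have hb0 : 0 < b.re := by rw [hbre]; positivity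
  let G : EuclideanSpace ℝ (Fin n) → ℂ := fun v => cexp (-b * ‖v‖ ^ 2)
  have hGnorm (v) : ‖G v‖ = rexp (-b.re * ‖v‖ ^ 2) := by
    simp only [G]
    rw [Complex.norm_exp]
    congr 1
    rw [← Complex.ofReal_pow, Complex.re_mul_ofReal, Complex.neg_re]
  have hGc : Continuous G := by fun_prop
  have hGi : Integrable G := by
    simpa [G] using GaussianFourier.integrable_cexp_neg_mul_sq_norm_add hb0 0
      (0 : EuclideanSpace ℝ (Fin n))
  have hmp := measurePreserving_latticeCoord Λ hcov
  have hemb : MeasurableEmbedding (latticeCoord Λ) :=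
    (latticeCoord Λ).toHomeomorph.measurableEmbedding
  let g : (Fin n → ℝ) → ℂ := fun x => G (latticeCoord Λ x)
  have hfour (x : Λ) : ∫ y, mFourier (-φ x) (toTorus y) * g y =
      (I / z) ^ (n / 2 : ℂ) *
        cexp (π * I * ((‖(x : EuclideanSpace ℝ (Fin n))‖ ^ 2 : ℝ) : ℂ) * (-1 / z)) := by
    have h1 := fourier_gaussian_innerProductSpace (V := EuclideanSpace ℝ (Fin n)) hb0 x
    rw [finrank_euclideanSpace_fin, Real.fourier_eq', ← hmp.integral_comp hemb] at h1
    have h2 : (π / b : ℂ) = I / z := by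
      rw [hb, div_eq_div_iff (by simp [pi_ne_zero, hz0]) hz0]
      linear_combination (π * z) * I_sq
    have h3 : (-π ^ 2 * ‖(x : EuclideanSpace ℝ (Fin n))‖ ^ 2 / b : ℂ) =
        π * I * ((‖(x : EuclideanSpace ℝ (Fin n))‖ ^ 2 : ℝ) : ℂ) * (-1 / z) := by
      rw [show (-π ^ 2 * ‖(x : EuclideanSpace ℝ (Fin n))‖ ^ 2 / b : ℂ) =
        -π * ‖(x : EuclideanSpace ℝ (Fin n))‖ ^ 2 * (π / b) by ring, h2]
      push_cast
      ring
    rw [h2, h3] at h1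
    rw [← h1]
    refine integral_congr_ae (Eventually.of_forall fun y => ?_)
    simp only [g, G, smul_eq_mul]
    congr 1
    rw [mFourier_toTorus]
    congr 1
    rw [latticeCoord_apply, sum_inner]
    simp only [inner_smul_left, hφ]
    push_cast
    simp only [Pi.neg_apply, Int.cast_neg, neg_mul, Finset.sum_neg_distrib, mul_neg, conj_trivial,
      neg_inj]
    rw [mul_right_comm]
    congr 2
    exact Finset.sum_congr rfl fun i _ => mul_comm _ _
  have him : 0 < (-1 / z).im := by
    rw [neg_div, Complex.neg_im, one_div, Complex.inv_im, neg_div, neg_neg]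
    exact div_pos hz (Complex.normSq_pos.mpr hz0)
  have hsum := (summable_latticeTheta_term Λ him).mul_left ((I / z) ^ (n / 2 : ℂ))
  have hsum' : Summable fun k : Fin n → ℤ => ∫ y, mFourier (-k) (toTorus y) * g y := by
    rw [← φ.summable_iff]
    exact hsum.congr fun x => (hfour x).symm
  have key := tsum_intVec_eq_tsum_fourier (g := g) (hGc.comp (latticeCoord Λ).continuous)
    (hmp.integrable_comp_emb hemb |>.mpr hGi) ?_ hsum'
  · rw [← φ.tsum_eq fun k => ∫ y, mFourier (-k) (toTorus y) * g y, tsum_congr hfour,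
      tsum_mul_left] at key
    rw [latticeTheta, ← (latticeBasis Λ).equivFun.symm.toEquiv.tsum_eq]
    refine Eq.trans (tsum_congr fun v => ?_) key
    simp only [g, G, latticeCoord_intVec, hb]
    congr 1
    push_cast
    simp only [LinearEquiv.coe_toEquiv]
    ring
  · intro R
    obtain ⟨K, hK⟩ : ∃ K : ℝ, ∀ x, ‖latticeCoord Λ x‖ ≤ K * ‖x‖ :=
      ⟨_, (latticeCoord Λ : (Fin n → ℝ) →L[ℝ] EuclideanSpace ℝ (Fin n)).le_opNorm⟩
    -- Since ‖q‖² ≤ 2‖p + q‖² + 2‖p‖², the shifted Gaussian is at most a constant depending on R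
    -- times the centred one with half the rate.
    have hs := (((latticeBasis Λ).equivFun.symm.toEquiv.summable_iff).mpr
      (summable_exp_neg_mul_norm_sq Λ (half_pos hb0))).mul_left (rexp (b.re * (|K| * R) ^ 2))
    refine ⟨_, hs, fun v x hx => ?_⟩
    simp only [g, hGnorm, map_add, latticeCoord_intVec, Function.comp_apply,
      LinearEquiv.coe_toEquiv]
    rw [← Real.exp_add]
    refine Real.exp_le_exp.mpr ?_
    set p := latticeCoord Λ x
    set q : EuclideanSpace ℝ (Fin n) := Λ.subtype ((latticeBasis Λ).equivFun.symm v) with hqdef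
    rw [Submodule.subtype_apply] at hqdef
    rw [← hqdef]
    have hp : ‖p‖ ≤ |K| * R := (hK x).trans
      (mul_le_mul (le_abs_self K) hx (norm_nonneg _) (abs_nonneg _))
    have hp2 : ‖p‖ ^ 2 ≤ (|K| * R) ^ 2 := pow_le_pow_left₀ (norm_nonneg _) hp 2
    have hq : ‖q‖ ≤ ‖p + q‖ + ‖p‖ := by
      simpa using norm_sub_le (p + q) p
    have hq2 : ‖q‖ ^ 2 / 2 ≤ ‖p + q‖ ^ 2 + ‖p‖ ^ 2 := by
      nlinarith [sq_nonneg (‖p + q‖ - ‖p‖), norm_nonneg q, norm_nonneg (p + q), norm_nonneg p]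
    nlinarith

/-- For 8 ∣ n the exponent n/2 is a multiple of 4, so the power of I is 1 and no branch is left. -/
theorem latticeTheta_neg_inv (hint : ∀ x ∈ Λ, ∀ y ∈ Λ, ∃ a : ℤ, inner ℝ x y = (a : ℝ))
    (hcov : ZLattice.covolume Λ = 1) {l : ℕ} (hn : n = 8 * l) {z : ℂ} (hz : 0 < z.im) :
    latticeTheta Λ (-1 / z) = z ^ (4 * l) * latticeTheta Λ z := by
  have hz0 : z ≠ 0 := ne_zero_of_im_pos hz
  rw [latticeTheta_eq_fourier Λ hint hcov hz,
    show (n / 2 : ℂ) = ((4 * l : ℕ) : ℂ) by rw [hn]; push_cast; ring, Complex.cpow_natCast, div_pow,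
    pow_mul I, I_pow_four, one_pow, ← mul_assoc, mul_one_div_cancel (pow_ne_zero _ hz0), one_mul]

theorem IsEvenUnimodular.isWeaklyModular_latticeTheta (hΛ : IsEvenUnimodular Λ) {l : ℕ}
    (hn : n = 8 * l) : IsWeaklyModular ((4 * l : ℕ) : ℤ) (latticeTheta Λ) where
  differentiableOn := differentiableOn_latticeTheta Λ
  add_one z _ := latticeTheta_add_one Λ hΛ.even z
  neg_inv z hz := by
    rw [zpow_natCast, latticeTheta_neg_inv Λ hΛ.integral hΛ.covolume_eq_one hn hz]

end FunctionalEquation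

/-! ### The theta series of ℤⁿ as a power of θ₃. -/

theorem summable_norm_prod_and_tsum_prod {f : ℤ → ℂ} (hf : Summable fun a => ‖f a‖) (n : ℕ) :
    (Summable fun v : Fin n → ℤ => ‖∏ i, f (v i)‖) ∧
      ∑' v : Fin n → ℤ, ∏ i, f (v i) = (∑' a, f a) ^ n := by
  induction n with
  | zero => exact ⟨.of_finite, by simp⟩
  | succ n ih =>
    have hterm (p : ℤ × (Fin n → ℤ)) :
        ∏ i, f ((Fin.consEquiv (fun _ : Fin (n + 1) => ℤ)) p i) = f p.1 * ∏ i, f (p.2 i) := by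
      simp [Fin.consEquiv, Fin.prod_univ_succ]
    constructor
    · rw [← (Fin.consEquiv (fun _ : Fin (n + 1) => ℤ)).summable_iff]
      refine (summable_mul_of_summable_norm hf ih.1).norm.congr fun p => ?_
      simp only [Function.comp_apply, hterm]
    · rw [← (Fin.consEquiv (fun _ : Fin (n + 1) => ℤ)).tsum_eq, tsum_congr hterm, pow_succ',
        ← ih.2, tsum_mul_tsum_of_summable_norm hf ih.1]

theorem latticeTheta_cubicLattice (n : ℕ) {z : ℂ} (hz : 0 < z.im) :
    latticeTheta (cubicLattice n) z = jacobiTheta z ^ n := by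
  have hs : Summable fun a : ℤ => ‖cexp (π * I * (a : ℂ) ^ 2 * z)‖ := by
    refine (((summable_jacobiTheta₂_term_iff 0 z).mpr hz).norm).congr fun a => ?_
    simp [jacobiTheta₂_term]
  rw [jacobiTheta, ← (summable_norm_prod_and_tsum_prod hs n).2, latticeTheta]
  let b := (EuclideanSpace.basisFun (Fin n) ℝ).toBasis.restrictScalars ℤ
  have hspan : Submodule.span ℤ (Set.range (EuclideanSpace.basisFun (Fin n) ℝ).toBasis) =
      cubicLattice n := by
    rw [OrthonormalBasis.coe_toBasis, cubicLattice]
  let e : (Fin n → ℤ) ≃ cubicLattice n :=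
    (b.equivFun.symm.trans (LinearEquiv.ofEq _ _ hspan)).toEquiv
  have he (v : Fin n → ℤ) (i : Fin n) : ((e v : EuclideanSpace ℝ (Fin n)) i) = v i := by
    have : (e v : EuclideanSpace ℝ (Fin n)) = ∑ j, v j • EuclideanSpace.basisFun (Fin n) ℝ j := by
      change ((b.equivFun.symm v : Submodule.span ℤ _) : EuclideanSpace ℝ (Fin n)) = _
      rw [Module.Basis.equivFun_symm_apply, Submodule.coe_sum]
      refine Finset.sum_congr rfl fun j _ => ?_
      rw [Submodule.coe_smul, Module.Basis.restrictScalars_apply, OrthonormalBasis.coe_toBasis]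
    rw [this]
    simp [Finset.sum_apply, Pi.single_apply]
  rw [← e.tsum_eq]
  refine tsum_congr fun v => ?_
  rw [← Complex.exp_sum, EuclideanSpace.norm_sq_eq]
  congr 1
  simp only [he, Real.norm_eq_abs, sq_abs]
  push_cast
  rw [Finset.mul_sum, Finset.sum_mul]

/-! ### Theta series on the imaginary axis. -/

section RealTheta

variable {n : ℕ} (Λ : Submodule ℤ (EuclideanSpace ℝ (Fin n)))

/-- The theta series of a lattice on the imaginary axis, as a real function. -/
noncomputable def realTheta (y : ℝ) : ℝ :=
  ∑' x : Λ, rexp (-π * y * ‖(x : EuclideanSpace ℝ (Fin n))‖ ^ 2)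

theorem latticeTheta_eq_realTheta (y : ℝ) : latticeTheta Λ (y * I) = (realTheta Λ y : ℂ) :=
  latticeTheta_mul_I Λ y

theorem secrecyFunction_eq (y : ℝ) :
    secrecyFunction Λ y = realTheta (cubicLattice n) y / realTheta Λ y := by
  rw [secrecyFunction, latticeTheta_eq_realTheta, latticeTheta_eq_realTheta, ← Complex.ofReal_div,
    Complex.ofReal_re]

theorem one_add_exp_pow_le_realTheta_cubicLattice (n : ℕ) {y : ℝ} (hy : 0 < y) :
    (1 + rexp (-π * y)) ^ n ≤ realTheta (cubicLattice n) y := by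
  obtain ⟨r, hr, h⟩ := exists_one_add_exp_le_jacobiTheta_mul_I hy
  have h2 := latticeTheta_cubicLattice n (z := y * I) (by simpa using hy)
  rw [latticeTheta_eq_realTheta, h] at h2
  rw [show realTheta (cubicLattice n) y = r ^ n by exact_mod_cast h2]
  exact pow_le_pow_left₀ (by positivity) hr n

theorem realTheta_cubicLattice_pos (n : ℕ) {y : ℝ} (hy : 0 < y) :
    0 < realTheta (cubicLattice n) y :=
  lt_of_lt_of_le (by positivity) (one_add_exp_pow_le_realTheta_cubicLattice n hy)

theorem realTheta_cubicLattice_inv {l : ℕ} (hn : n = 8 * l) {y : ℝ} (hy : 0 < y) :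
    realTheta (cubicLattice n) y⁻¹ = y ^ (4 * l) * realTheta (cubicLattice n) y := by
  have him : 0 < ((y : ℂ) * I).im := by simpa using hy
  have him' : 0 < ((y⁻¹ : ℝ) * I : ℂ).im := by simpa using hy
  have h := jacobiTheta_neg_inv_pow him
  rw [neg_one_div_mul_I hy] at h
  have key : latticeTheta (cubicLattice n) ((y⁻¹ : ℝ) * I) =
      y ^ (4 * l) * latticeTheta (cubicLattice n) (y * I) := by
    rw [latticeTheta_cubicLattice n him, latticeTheta_cubicLattice n him', hn,
      show 8 * l = 4 * (2 * l) by ring, pow_mul, pow_mul, h, mul_pow (y : ℂ), I_sq]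
    ring
  rw [latticeTheta_eq_realTheta, latticeTheta_eq_realTheta] at key
  exact_mod_cast key

theorem tendsto_mul_I_of_atImInfty {α : Type*} {g : ℂ → α} {l : Filter α}
    (h : Tendsto (fun z : ℍ => g z) atImInfty l) :
    Tendsto (fun y : ℝ => g (y * I)) atTop l := by
  have h1 : Tendsto (fun y : ℝ => ofComplex (y * I)) atTop atImInfty := by
    refine tendsto_comap_iff.mpr (tendsto_id.congr' ?_)
    filter_upwards [eventually_gt_atTop 0] with y hy
    rw [Function.comp_apply, ofComplex_apply_of_im_pos (by simpa using hy)]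
    simp [UpperHalfPlane.im]
  refine (h.comp h1).congr' ?_
  filter_upwards [eventually_gt_atTop 0] with y hy
  rw [Function.comp_apply, ofComplex_apply_of_im_pos (by simpa using hy)]

theorem tendsto_realTheta_cubicLattice (n : ℕ) :
    Tendsto (realTheta (cubicLattice n)) atTop (𝓝 1) := by
  have h := tendsto_mul_I_of_atImInfty (g := fun z => jacobiTheta z ^ n)
    (tendsto_jacobiTheta_atImInfty.pow n)
  rw [one_pow] at h
  have h2 := (Complex.continuous_re.tendsto _).comp h
  refine (h2.congr' ?_)
  filter_upwards [eventually_gt_atTop 0] with y hy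
  rw [Function.comp_apply, ← latticeTheta_cubicLattice n (by simpa using hy),
    latticeTheta_eq_realTheta, Complex.ofReal_re]

theorem continuousOn_realTheta_of_differentiableOn
    (h : DifferentiableOn ℂ (latticeTheta Λ) {z | 0 < z.im}) :
    ContinuousOn (realTheta Λ) (Set.Ioi 0) := by
  have h1 : ContinuousOn (fun y : ℝ => latticeTheta Λ (y * I)) (Set.Ioi 0) :=
    h.continuousOn.comp (by fun_prop) fun y hy => by simpa using hy
  refine (Complex.continuous_re.comp_continuousOn h1).congr fun y _ => ?_
  rw [Function.comp_apply, latticeTheta_eq_realTheta, Complex.ofReal_re]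

theorem continuousOn_realTheta_cubicLattice (n : ℕ) :
    ContinuousOn (realTheta (cubicLattice n)) (Set.Ioi 0) :=
  continuousOn_realTheta_of_differentiableOn _ <|
    (differentiableOn_jacobiTheta.pow n).congr fun _ hz => latticeTheta_cubicLattice n hz

variable [DiscreteTopology Λ]

theorem one_le_realTheta {y : ℝ} (hy : 0 < y) : 1 ≤ realTheta Λ y := by
  have hs := summable_exp_neg_mul_norm_sq Λ (mul_pos pi_pos hy)
  simp only [← neg_mul] at hs
  simpa [realTheta] using hs.le_tsum 0 fun x _ => (Real.exp_pos _).le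

theorem realTheta_pos {y : ℝ} (hy : 0 < y) : 0 < realTheta Λ y :=
  one_pos.trans_le (one_le_realTheta Λ hy)

variable [IsZLattice ℝ Λ] {Λ}

theorem IsEvenUnimodular.realTheta_inv (hΛ : IsEvenUnimodular Λ) {l : ℕ} (hn : n = 8 * l) {y : ℝ}
    (hy : 0 < y) : realTheta Λ y⁻¹ = y ^ (4 * l) * realTheta Λ y := by
  have h := latticeTheta_neg_inv Λ hΛ.integral hΛ.covolume_eq_one hn
    (z := y * I) (by simpa using hy)
  rw [neg_one_div_mul_I hy, latticeTheta_eq_realTheta, latticeTheta_eq_realTheta, mul_pow,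
    pow_mul I, I_pow_four, one_pow, mul_one] at h
  exact_mod_cast h

theorem IsEvenUnimodular.two_le_norm_sq (hΛ : IsEvenUnimodular Λ) (x) (hx : x ∈ Λ) (hx0 : x ≠ 0) :
    2 * ((1 : ℕ) : ℝ) ≤ ‖x‖ ^ 2 := by
  obtain ⟨a, ha⟩ := hΛ.even x hx
  have h0 : 0 < ‖x‖ ^ 2 := by positivity
  have h1 : 0 < (a : ℝ) := by linarith
  have h2 : (1 : ℝ) ≤ a := by exact_mod_cast (by exact_mod_cast h1 : 0 < a)
  rw [ha]
  push_cast
  linarith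

/-- Nonzero vectors have length at least 2, so Θ_Λ - 1 is O(exp(-2πy)). This is negligible against
exp(-πy), the order contributed by the unit vectors of ℤⁿ. -/
theorem IsEvenUnimodular.tendsto_realTheta_sub_one_mul_exp (hΛ : IsEvenUnimodular Λ) :
    Tendsto (fun y => (realTheta Λ y - 1) * rexp (π * y)) atTop (𝓝 0) := by
  have h := tendsto_mul_I_of_atImInfty
    (g := fun z => (latticeTheta Λ z - 1) / cexp (2 * π * I * z) ^ 1)
    (tendsto_latticeTheta_sub_one_div Λ 1 hΛ.two_le_norm_sq)
  have h2 := (Complex.continuous_re.tendsto _).comp h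
  have h3 : Tendsto (fun y : ℝ => rexp (-π * y)) atTop (𝓝 0) :=
    Real.tendsto_exp_atBot.comp (tendsto_id.const_mul_atTop_of_neg (by simp [pi_pos]))
  have h4 := h2.mul h3
  rw [mul_zero] at h4
  refine h4.congr fun y => ?_
  have h5 : cexp (2 * π * I * (y * I)) = (rexp (-(2 * π * y)) : ℂ) := by
    rw [Complex.ofReal_exp]
    congr 1
    push_cast
    linear_combination (2 * π * y) * I_sq
  have h6 : (latticeTheta Λ (y * I) - 1) / cexp (2 * π * I * (y * I)) ^ 1 =
      (((realTheta Λ y - 1) / rexp (-(2 * π * y)) : ℝ) : ℂ) := by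
    rw [latticeTheta_eq_realTheta, h5, pow_one]
    push_cast
    rfl
  simp only [Function.comp_apply]
  rw [h6, Complex.ofReal_re, div_eq_mul_inv, ← Real.exp_neg, mul_assoc, ← Real.exp_add]
  congr 2
  ring

theorem IsEvenUnimodular.tendsto_realTheta (hΛ : IsEvenUnimodular Λ) :
    Tendsto (realTheta Λ) atTop (𝓝 1) := by
  have h3 : Tendsto (fun y : ℝ => rexp (-π * y)) atTop (𝓝 0) :=
    Real.tendsto_exp_atBot.comp (tendsto_id.const_mul_atTop_of_neg (by simp [pi_pos]))
  have h := (hΛ.tendsto_realTheta_sub_one_mul_exp.mul h3).add_const 1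
  rw [mul_zero, zero_add] at h
  refine h.congr fun y => ?_
  rw [mul_assoc, ← Real.exp_add]
  simp

end RealTheta

/-! ### Existence of the maximum. -/

/-- A continuous function on `(0, ∞)` which is invariant under `y ↦ y⁻¹`, tends to `1` at infinity
and takes a value greater than `1` attains its maximum. -/
theorem exists_isMaxOn_Ioi_of_inv_invariant {f : ℝ → ℝ} (hc : ContinuousOn f (Set.Ioi 0))
    (hinv : ∀ y, 0 < y → f y⁻¹ = f y) (hlim : Tendsto f atTop (𝓝 1)) {y₀ : ℝ} (hy₀ : 0 < y₀)
    (h1 : 1 < f y₀) : ∃ y, 0 < y ∧ IsMaxOn f (Set.Ioi 0) y := by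
  obtain ⟨Y, hY⟩ := eventually_atTop.mp (hlim.eventually_lt_const h1)
  -- The interval [1/Z, Z] contains y₀, and beyond Z the values stay below f(y₀); inversion handles
  -- arguments below 1/Z.
  set Z := max Y (max y₀ (max y₀⁻¹ 1)) with hZ
  have hZ1 : 1 ≤ Z := by simp [hZ]
  have hZ0 : 0 < Z := by linarith
  have hZy : y₀ ≤ Z := by simp [hZ]
  have hZy' : Z⁻¹ ≤ y₀ := inv_le_of_inv_le₀ hy₀ (by simp [hZ])
  have hsub : Set.Icc Z⁻¹ Z ⊆ Set.Ioi 0 := fun y hy => lt_of_lt_of_le (inv_pos.mpr hZ0) hy.1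
  obtain ⟨y, hy, hmax⟩ := isCompact_Icc.exists_isMaxOn ⟨y₀, hZy', hZy⟩ (hc.mono hsub)
  have hge : f y₀ ≤ f y := hmax ⟨hZy', hZy⟩
  have hlarge (w : ℝ) (hw : Z ≤ w) : f w ≤ f y :=
    ((hY w (le_trans (by simp [hZ]) hw)).trans_le hge).le
  refine ⟨y, hsub hy, fun w hw => ?_⟩
  have hw0 : 0 < w := hw
  rcases le_total w Z with h | h
  · rcases le_total Z⁻¹ w with h' | h'
    · exact hmax ⟨h', h⟩
    · have := hlarge w⁻¹ ((le_inv_comm₀ hw0 hZ0).mp h')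
      rw [hinv w hw0] at this
      exact this
  · exact hlarge w h

theorem isGreatest_secrecyGain_of_isMaxOn {n : ℕ} {Λ : Submodule ℤ (EuclideanSpace ℝ (Fin n))}
    {y : ℝ} (hy : 0 < y) (h : IsMaxOn (secrecyFunction Λ) (Set.Ioi 0) y) :
    IsGreatest (secrecyFunction Λ '' Set.Ioi 0) (secrecyFunction Λ y) := by
  refine ⟨⟨y, hy, rfl⟩, ?_⟩
  rintro _ ⟨w, hw, rfl⟩
  exact h hw

theorem secrecyGain_eq_of_isMaxOn {n : ℕ} {Λ : Submodule ℤ (EuclideanSpace ℝ (Fin n))}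
    {y : ℝ} (hy : 0 < y) (h : IsMaxOn (secrecyFunction Λ) (Set.Ioi 0) y) :
    secrecyGain Λ = secrecyFunction Λ y :=
  (isGreatest_secrecyGain_of_isMaxOn hy h).csSup_eq

theorem IsEvenUnimodular.exists_isMaxOn_secrecyFunction {n l : ℕ} (hn : n = 8 * l)
    {Λ : Submodule ℤ (EuclideanSpace ℝ (Fin n))} [DiscreteTopology Λ] [IsZLattice ℝ Λ]
    (hΛ : IsEvenUnimodular Λ) :
    ∃ y, 0 < y ∧ IsMaxOn (secrecyFunction Λ) (Set.Ioi 0) y := by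
  -- In dimension 0 the secrecy function is constant and never exceeds 1, so the general argument
  -- does not apply.
  rcases Nat.eq_zero_or_pos n with h0 | hpos
  · subst h0
    have h1 (y : ℝ) : secrecyFunction Λ y = secrecyFunction Λ 1 := by
      simp [secrecyFunction_eq, realTheta, Subsingleton.elim _ (0 : EuclideanSpace ℝ (Fin 0))]
    exact ⟨1, one_pos, fun y _ => (h1 y).le⟩
  · have heq : secrecyFunction Λ = fun y => realTheta (cubicLattice n) y / realTheta Λ y :=
      funext (secrecyFunction_eq Λ)
    obtain ⟨y₀, hlt, hy₀⟩ := ((hΛ.tendsto_realTheta_sub_one_mul_exp.eventually_lt_const one_pos).and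
      (eventually_gt_atTop 0)).exists
    refine exists_isMaxOn_Ioi_of_inv_invariant ?_ ?_ ?_ hy₀ ?_
    · rw [heq]
      exact (continuousOn_realTheta_cubicLattice n).div
        (continuousOn_realTheta_of_differentiableOn Λ (differentiableOn_latticeTheta Λ))
        fun y hy => (realTheta_pos Λ hy).ne'
    · intro y hy
      rw [heq]
      simp only [realTheta_cubicLattice_inv hn hy, hΛ.realTheta_inv hn hy]
      exact mul_div_mul_left _ _ (pow_pos hy _).ne'
    · rw [heq]
      have h := (tendsto_realTheta_cubicLattice n).div hΛ.tendsto_realTheta one_ne_zero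
      rw [div_one] at h
      exact h
    · rw [secrecyFunction_eq, one_lt_div (realTheta_pos Λ hy₀)]
      have hE := Real.exp_pos (-π * y₀)
      have h1 : realTheta Λ y₀ < 1 + rexp (-π * y₀) := by
        have := mul_lt_mul_of_pos_right hlt hE
        rw [mul_assoc, ← Real.exp_add] at this
        simp at this
        simp
        linarith
      refine h1.trans_le (le_trans ?_ (one_add_exp_pow_le_realTheta_cubicLattice n hy₀))
      exact le_self_pow₀ (by linarith) hpos.ne'

/-! ### Comparison of two lattices and the main theorem. -/

/-- For m = 0 the count includes the zero vector, which the cusp expansion leaves out. The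
correction is the same for both lattices and cancels in differences. -/
theorem numVectors_eq {n : ℕ} (Λ : Submodule ℤ (EuclideanSpace ℝ (Fin n))) (m : ℕ) :
    numVectors Λ (2 * m) = {x : EuclideanSpace ℝ (Fin n) | x ∈ Λ ∧ x ≠ 0 ∧ ‖x‖ ^ 2 = 2 * m}.ncard +
      if m = 0 then 1 else 0 := by
  rw [numVectors]
  split_ifs with hm
  · subst hm
    have h1 : {x : EuclideanSpace ℝ (Fin n) | x ∈ Λ ∧ ‖x‖ ^ 2 = ((2 * 0 : ℕ) : ℝ)} = {0} := by
      ext x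
      simp +contextual
    have h2 : {x : EuclideanSpace ℝ (Fin n) | x ∈ Λ ∧ x ≠ 0 ∧ ‖x‖ ^ 2 = 2 * ((0 : ℕ) : ℝ)} = ∅ := by
      ext x
      simp +contextual
    rw [h1, h2]
    simp
  · rw [add_zero]
    congr 1
    ext x
    have : x = 0 → ‖x‖ ^ 2 ≠ 2 * (m : ℝ) := by
      rintro rfl
      simpa using hm
    simp only [Set.mem_ofPred_eq]
    push_cast
    tauto

/-- Two even unimodular lattices of dimension `24m + 8k`, `k ≤ 2`, with minimal length at least
`2m` have theta series differing by a multiple of `Δ ^ m E₄ ^ k`. -/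
theorem latticeTheta_sub_eq {n m k : ℕ} (hk : k ≤ 2) (hn : n = 24 * m + 8 * k)
    {Λ Λ' : Submodule ℤ (EuclideanSpace ℝ (Fin n))}
    [DiscreteTopology Λ] [IsZLattice ℝ Λ] [DiscreteTopology Λ'] [IsZLattice ℝ Λ']
    (hΛ : IsEvenUnimodular Λ) (hΛ' : IsEvenUnimodular Λ')
    (hmin : ∀ x ∈ Λ, x ≠ 0 → 2 * (m : ℝ) ≤ ‖x‖ ^ 2)
    (hmin' : ∀ x ∈ Λ', x ≠ 0 → 2 * (m : ℝ) ≤ ‖x‖ ^ 2) {z : ℂ} (hz : 0 < z.im) :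
    latticeTheta Λ z - latticeTheta Λ' z =
      ((numVectors Λ (2 * m) : ℂ) - numVectors Λ' (2 * m)) * (etaPow z ^ m * thetaEight z ^ k) := by
  have hn' : n = 8 * (3 * m + k) := by rw [hn]; ring
  set c : ℂ := (numVectors Λ (2 * m) : ℂ) - numVectors Λ' (2 * m) with hc
  have hmod := ((hΛ.isWeaklyModular_latticeTheta Λ hn').sub
    (hΛ'.isWeaklyModular_latticeTheta Λ' hn')).div (isWeaklyModular_etaPow.pow m)
    fun w hw => pow_ne_zero m (etaPow_ne_zero w hw)
  rw [show ((4 * (3 * m + k) : ℕ) : ℤ) - 12 * m = 4 * k by push_cast; ring] at hmod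
  have hmod2 := hmod.sub ((isWeaklyModular_thetaEight.pow k).const_mul c)
  have hlim := (((tendsto_latticeTheta_sub_one_div Λ m hmin).sub
    (tendsto_latticeTheta_sub_one_div Λ' m hmin')).div (tendsto_etaPow_div_exp.pow m)
    (by simp)).sub ((tendsto_thetaEight_atImInfty.pow k).const_mul c)
  have hzero : ({x : EuclideanSpace ℝ (Fin n) | x ∈ Λ ∧ x ≠ 0 ∧ ‖x‖ ^ 2 = 2 * m}.ncard -
      {x : EuclideanSpace ℝ (Fin n) | x ∈ Λ' ∧ x ≠ 0 ∧ ‖x‖ ^ 2 = 2 * m}.ncard : ℂ) / 1 ^ m -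
      c * 1 ^ k = 0 := by
    rw [hc, numVectors_eq, numVectors_eq]
    push_cast
    simp
  rw [hzero] at hlim
  have h := hmod2.eq_zero_of_weight_lt_twelve (by omega) (hlim.congr fun w => ?_) hz
  · have h0 := pow_ne_zero m (etaPow_ne_zero z hz)
    rw [sub_eq_zero, div_eq_iff h0] at h
    rw [h]
    ring
  · have h0 := pow_ne_zero m (etaPow_ne_zero w w.2)
    have h1 := pow_ne_zero m (Complex.exp_ne_zero (2 * π * I * w))
    simp only [Pi.div_apply, div_pow]
    rw [← sub_div, div_div_div_cancel_right₀ h1]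
    ring

theorem theorem1 (n m k : ℕ) (hk : k ∈ ({0, 1, 2} : Set ℕ)) (hn : n = 24 * m + 8 * k)
    (Λ Λ' : Submodule ℤ (EuclideanSpace ℝ (Fin n)))
    [DiscreteTopology Λ] [IsZLattice ℝ Λ] [DiscreteTopology Λ'] [IsZLattice ℝ Λ']
    (hΛ : IsEvenUnimodular Λ) (hΛ' : IsEvenUnimodular Λ')
    (hmin : ∀ x ∈ Λ, x ≠ 0 → 2 * (m : ℝ) ≤ ‖x‖ ^ 2)
    (hmin' : ∀ x ∈ Λ', x ≠ 0 → 2 * (m : ℝ) ≤ ‖x‖ ^ 2) :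
    -- the secrecy gains are attained maxima
    IsGreatest (secrecyFunction Λ '' Set.Ioi 0) (secrecyGain Λ) ∧
    IsGreatest (secrecyFunction Λ' '' Set.Ioi 0) (secrecyGain Λ') ∧
    (numVectors Λ' (2 * m) < numVectors Λ (2 * m) →
      (∀ y : ℝ, 0 < y → secrecyFunction Λ y < secrecyFunction Λ' y) ∧
      secrecyGain Λ < secrecyGain Λ') ∧
    (SatisfiesBelfioreSole Λ → SatisfiesBelfioreSole Λ' →
      (secrecyGain Λ)⁻¹ - (secrecyGain Λ')⁻¹ =
        ((numVectors Λ (2 * m) : ℝ) - (numVectors Λ' (2 * m) : ℝ)) *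
          ((3 : ℝ) ^ k / (4 : ℝ) ^ (6 * m + k))) := by
  have hk2 : k ≤ 2 := by
    rcases hk with rfl | rfl | rfl <;> norm_num
  have hn' : n = 8 * (3 * m + k) := by rw [hn]; ring
  obtain ⟨y, hy, hmax⟩ := hΛ.exists_isMaxOn_secrecyFunction hn'
  obtain ⟨y', hy', hmax'⟩ := hΛ'.exists_isMaxOn_secrecyFunction hn'
  refine ⟨?_, ?_, fun hlt => ?_, fun hBS hBS' => ?_⟩
  · rw [secrecyGain_eq_of_isMaxOn hy hmax]
    exact isGreatest_secrecyGain_of_isMaxOn hy hmax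
  · rw [secrecyGain_eq_of_isMaxOn hy' hmax']
    exact isGreatest_secrecyGain_of_isMaxOn hy' hmax'
  · have hpt : ∀ w : ℝ, 0 < w → secrecyFunction Λ w < secrecyFunction Λ' w := by
      intro w hw
      have h := latticeTheta_sub_eq hk2 hn hΛ hΛ' hmin hmin' (z := w * I) (by simpa using hw)
      obtain ⟨a, ha, hηa⟩ := exists_pos_etaPow_mul_I hw
      obtain ⟨b, hb, hθb⟩ := exists_pos_thetaEight_mul_I hw
      rw [hηa, hθb, latticeTheta_eq_realTheta, latticeTheta_eq_realTheta] at h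
      have h' : realTheta Λ w - realTheta Λ' w =
          ((numVectors Λ (2 * m) : ℝ) - numVectors Λ' (2 * m)) * (a ^ m * b ^ k) := by
        exact_mod_cast h
      have hc : (0 : ℝ) < (numVectors Λ (2 * m) : ℝ) - numVectors Λ' (2 * m) :=
        sub_pos.mpr (by exact_mod_cast hlt)
      have hpos := mul_pos hc (mul_pos (pow_pos ha m) (pow_pos hb k))
      rw [secrecyFunction_eq, secrecyFunction_eq]
      exact div_lt_div_of_pos_left (realTheta_cubicLattice_pos n hw) (realTheta_pos Λ' hw)
        (by linarith)
    refine ⟨hpt, ?_⟩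
    rw [secrecyGain_eq_of_isMaxOn hy hmax, secrecyGain_eq_of_isMaxOn hy' hmax']
    -- Comparing at a maximizer of Ξ_Λ keeps the inequality strict.
    exact (hpt y hy).trans_le (hmax' hy)
  · rw [secrecyGain_eq_of_isMaxOn one_pos hBS, secrecyGain_eq_of_isMaxOn one_pos hBS',
      secrecyFunction_eq, secrecyFunction_eq, inv_div, inv_div, ← sub_div,
      div_eq_iff (realTheta_cubicLattice_pos n one_pos).ne']
    have h := latticeTheta_sub_eq hk2 hn hΛ hΛ' hmin hmin' (z := I) (by simp)
    have hZ := latticeTheta_cubicLattice n (z := I) (by simp)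
    have hI : I = ((1 : ℝ) : ℂ) * I := by simp
    rw [etaPow_I, thetaEight_I, div_pow, mul_pow, ← pow_mul, ← pow_mul, ← pow_mul] at h
    -- Δ(i)^m E₄(i)^k is a multiple of θ₃(i)ⁿ = Θ_{ℤⁿ}(i), because 24m + 8k = n; the factor is the
    -- constant in (b).
    have hpow : jacobiTheta I ^ (24 * m) / 4 ^ (6 * m) * ((3 / 4) ^ k * jacobiTheta I ^ (8 * k)) =
        3 ^ k / 4 ^ (6 * m + k) * jacobiTheta I ^ n := by
      rw [hn, pow_add, pow_add, div_pow]
      field_simp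
    rw [hpow, ← hZ, hI, latticeTheta_eq_realTheta, latticeTheta_eq_realTheta,
      latticeTheta_eq_realTheta, ← mul_assoc] at h
    refine Complex.ofReal_injective ?_
    push_cast
    exact h
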